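/- **Types.** The types of the guarded $\lambda$-calculus ($\mathsf{g}\lambda$-calculus) are $A ::= \alpha \mid \mathbf N \mid \mathbf 1 \mid A\times A \mid \mathbf 0 \mid A+A \mid A\to A \mid \mu\alpha.A \mid \blacktriangleright A \mid \blacksquare A$, where $\mu\alpha.A$ may be formed only if every occurrence of $\alpha$ in $A$ lies beneath a $\blacktriangleright$, and $\blacksquare A$ only if $A$ is closed. A type is *constant* if every $\blacktriangleright$ in it lies beneath a $\blacksquare$. Below, types are closed unless said otherwise. **Terms.** The (untyped) terms are $$t ::= x \mid \mathsf{zero} \mid \mathsf{succ}\,t \mid \langle\rangle \mid \langle t,t\rangle \mid \pi_1 t\mid\pi_2 t \mid \mathsf{abort}\,t \mid \mathsf{in}_1 t\mid \mathsf{in}_2 t \mid \mathsf{case}\,t\,\mathsf{of}\,x_1.t;x_2.t \mid \lambda x.t \mid t\,t \mid \mathsf{fold}\,t \mid \mathsf{unfold}\,t \mid \mathsf{next}\,t \mid \mathsf{prev}\,\sigma.t \mid t\circledast t \mid \mathsf{box}\,\sigma.t \mid \mathsf{unbox}\,t \mid \mathsf{box}^+\sigma.t,$$ where $\sigma=[x_1\leftarrow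 t_1,\dots,x_n\leftarrow t_n]$ is an explicit substitution, which binds all the free variables of the term $t$ that follows it. The typing rules are the usual ones for variables, natural numbers, products, sums, functions and iso-recursive types ($\mathsf{fold}: A[\mu\alpha.A/\alpha]\to\mu\alpha.A$, with inverse $\mathsf{unfold}$), together with: if $\Gamma\vdash t:A$ then $\Gamma\vdash\mathsf{next}\,t:\blacktriangleright A$; if $\Gamma\vdash t_1:\blacktriangleright(A\to B)$ and $\Gamma\vdash t_2:\blacktriangleright A$ then $\Gamma\vdash t_1\circledast t_2:\blacktriangleright B$; if $\Gamma\vdash t:\blacksquare A$ then $\Gamma\vdash\mathsf{unbox}\,t:A$; and, whenever $A_1,\dots,A_n$ are constant and $\Gamma\vdash t_k:A_k$ for all $k$, then for $\Delta = x_1:A_1,\dots,x_n:A_n$ and $\sigma=[x_1\leftarrow t_1,\dots,x_n\leftarrow t_n]$: if $\Delta\vdash t:\blacktriangleright A$ then $\Gamma\vdash\mathsf{prev}\,\sigma.t:A$; if $\Delta\vdash t:A$ then $\Gamma\vdash\mathsf{box}\,\sigma.t:\blacksquare A$; if $\Delta\vdash t:B_1+B_2$ then $\Gamma\vdash\mathsf{box}^+\sigma.t:\blacksquare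 B_1+\blacksquare B_2$. **Reduction.** Call-by-name reduction $\mapsto$ on closed terms is the closure of the following rules under the evaluation contexts below (we write $\mathsf{prev}\,t$ etc. for the empty explicit substitution; $d\in\{1,2\}$): $\pi_d\langle t_1,t_2\rangle\mapsto t_d$; $\;\mathsf{case}\,\mathsf{in}_d t\,\mathsf{of}\,x_1.t_1;x_2.t_2\mapsto t_d[t/x_d]$; $\;(\lambda x.t_1)t_2\mapsto t_1[t_2/x]$; $\;\mathsf{unfold}\,\mathsf{fold}\,t\mapsto t$; $\;\mathsf{prev}[\vec x\leftarrow\vec t\,].t\mapsto\mathsf{prev}(t[\vec t/\vec x])$ for $\vec x$ non-empty; $\;\mathsf{prev}\,\mathsf{next}\,t\mapsto t$; $\;\mathsf{next}\,t_1\circledast\mathsf{next}\,t_2\mapsto\mathsf{next}(t_1t_2)$; $\;\mathsf{unbox}(\mathsf{box}[\vec x\leftarrow\vec t\,].t)\mapsto t[\vec t/\vec x]$; $\;\mathsf{box}^+[\vec x\leftarrow\vec t\,].t\mapsto\mathsf{box}^+(t[\vec t/\vec x])$ for $\vec x$ non-empty; $\;\mathsf{box}^+\mathsf{in}_d t\mapsto\mathsf{in}_d\,\mathsf{box}\,t$.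 Values are $v ::= \mathsf{succ}^n\mathsf{zero}\mid\langle\rangle\mid\langle t,t\rangle\mid\mathsf{in}_d t\mid\lambda x.t\mid\mathsf{fold}\,t\mid\mathsf{next}\,t\mid\mathsf{box}\,\sigma.t$, and evaluation contexts are $E ::= \cdot\mid\mathsf{succ}\,E\mid\pi_d E\mid\mathsf{case}\,E\,\mathsf{of}\,x_1.t_1;x_2.t_2\mid E\,t\mid\mathsf{unfold}\,E\mid\mathsf{prev}\,E\mid E\circledast t\mid v\circledast E\mid\mathsf{unbox}\,E\mid\mathsf{box}^+E$. **Contextual equivalence.** Terms $t_1,t_2$ of type $A$ in context $\Gamma$ are *contextually equivalent* if for every well-typed closing one-hole context $C$ of type $\mathbf N$, whose hole expects a term of type $A$ in context $\Gamma$, there is a value to which both $C[t_1]$ and $C[t_2]$ reduce in finitely many (possibly zero) steps. **Semantics.** The topos of trees $\mathcal S$ has as objects the sequences of sets $X_1\leftarrow X_2\leftarrow\cdots$ with restriction functions, and as arrows the natural families of functions. Types denote objects of $\mathcal S$: $\mathbf N,\mathbf 1,\mathbf 0$ are the constant objects on $\mathbb N$, a singleton and $\emptyset$; $\times,+,\to$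 are products, coproducts and exponentials; $(\blacktriangleright X)_1$ is a singleton and $(\blacktriangleright X)_{i+1}=X_i$; $\blacksquare X$ is the constant object on the set of global elements $1\to X$; and $[\![\mu\alpha.A]\!]$ is the fixed point, unique up to isomorphism, of $X\mapsto[\![A]\!](X)$, so that $[\![\mu\alpha.A]\!]\cong[\![A[\mu\alpha.A/\alpha]]\!]$. Typed terms $\Gamma\vdash t:A$ denote arrows $[\![\Gamma]\!]\to[\![A]\!]$ by recursion on a typing derivation, where the term-formers for $\mathbf N,\times,+,\to$ have the standard meaning in $\mathcal S$; $\mathsf{fold},\mathsf{unfold}$ are composition with the isomorphism above; $\mathsf{next}$ is composition with the natural map $X\to\blacktriangleright X$ given by restriction; $\mathsf{unbox}$ is composition with the counit $\blacksquare X\to X$; $\circledast$ is application one stage later; and, as constant types denote constant objects, a value of an explicit substitution $\sigma$ at stage $i$ determines values at all stages $j$, at which $t$ is evaluated: $[\![\mathsf{prev}\,\sigma.t]\!]_i$ is the value of $t$ at stage $i+1$, $[\![\mathsf{box}\,\sigma.t]\!]_i$ is the global element formed by the values of $t$ at all stages $j$, and $[\![\mathsf{box}^+\sigma.t]\!]_i$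 is this global element of $B_1+B_2$, regarded as a global element of $B_1$ or of $B_2$. **The logic.** The program logic $L\mathsf{g}\lambda$ is the typed higher-order logic with equality given by the internal logic of $\mathcal S$. Its types and terms are those of the $\mathsf{g}\lambda$-calculus with the denotations above; the type of propositions is $\mu\alpha.(\mathbf 1+\blacktriangleright\alpha)$, whose denotation is the subobject classifier. Propositions in context $\Gamma$ are built from equations $t=_A u$ and terms of the type of propositions by $\top,\bot,\wedge,\vee,\Rightarrow$, quantifiers $\forall x:A$, $\exists x:A$, and the modalities 'later' $\triangleright$ and 'always' $\square$. They are interpreted as subobjects of $[\![\Gamma]\!]$ in the standard way; $\triangleright P$ contains all of stage $1$, and at stage $i+1$ those $x$ whose restriction to stage $i$ is in $P$; and $\square$ is the right adjoint of $\neg\neg$ on the poset of subobjects of $[\![\Gamma]\!]$. A sequent $\Gamma\mid\Xi\vdash\varphi$ is *provable* if it holds in the internal logic of $\mathcal S$, that is, if the intersection of the subobjects interpreting the propositions in $\Xi$ is contained in the subobject interpreting $\varphi$. **Theorem.** Let $\Gamma$ be a typing context and let $t_1$ and $t_2$ be two $\mathsf{g}\lambda$-terms of type $A$ in context $\Gamma$.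 If the sequent $\Gamma\mid\emptyset\vdash t_1=_A t_2$ is provable in $L\mathsf{g}\lambda$, with $t_1$ and $t_2$ interpreted along any typing derivations $\Gamma\vdash t_1:A$ and $\Gamma\vdash t_2:A$, then $t_1$ and $t_2$ are contextually equivalent. -/

import Mathlib

namespace GuardedLambda

/-! ### Types -/

/-- Open types with `n` free type variables (de Bruijn indices). The constant type-former `box`
(written `■`) is applied to closed types only, as the type formation rules demand. -/
inductive Ty : ℕ → Type
  | var {n : ℕ} (k : Fin n) : Ty n
  | nat {n : ℕ} : Ty n
  | one {n : ℕ} : Ty n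
  | prod {n : ℕ} (A B : Ty n) : Ty n
  | empty {n : ℕ} : Ty n
  | sum {n : ℕ} (A B : Ty n) : Ty n
  | arr {n : ℕ} (A B : Ty n) : Ty n
  | mu {n : ℕ} (A : Ty (n + 1)) : Ty n
  | later {n : ℕ} (A : Ty n) : Ty n
  | box {n : ℕ} (A : Ty 0) : Ty n

namespace Ty

/-- Every occurrence of the variable `k` is beneath an occurrence of `later`. -/
def GuardedIn : {n : ℕ} → Fin n → Ty n → Prop
  | _, k, var j => k ≠ j
  | _, _, nat => True
  | _, _, one => True
  | _, k, prod A B => GuardedIn k A ∧ GuardedIn k B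
  | _, _, empty => True
  | _, k, sum A B => GuardedIn k A ∧ GuardedIn k B
  | _, k, arr A B => GuardedIn k A ∧ GuardedIn k B
  | _, k, mu A => GuardedIn k.succ A
  | _, _, later _ => True
  | _, _, box _ => True

/-- Well-formed types: `mu` binds guarded variables only. -/
def WF : {n : ℕ} → Ty n → Prop
  | _, var _ => True
  | _, nat => True
  | _, one => True
  | _, prod A B => WF A ∧ WF B
  | _, empty => True
  | _, sum A B => WF A ∧ WF B
  | _, arr A B => WF A ∧ WF B
  | _, mu A => GuardedIn 0 A ∧ WF A
  | _, later A => WF A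
  | _, box A => WF A

/-- Constant types: every occurrence of `later` is beneath an occurrence of `box`. -/
def Constant : {n : ℕ} → Ty n → Prop
  | _, var _ => True
  | _, nat => True
  | _, one => True
  | _, prod A B => Constant A ∧ Constant B
  | _, empty => True
  | _, sum A B => Constant A ∧ Constant B
  | _, arr A B => Constant A ∧ Constant B
  | _, mu A => Constant A
  | _, later _ => False
  | _, box _ => True

/-- Renaming of type variables. -/
def rename : {n m : ℕ} → (Fin n → Fin m) → Ty n → Ty m
  | _, _, f, var k => var (f k)
  | _, _, _, nat => nat
  | _, _, _, one => one
  | _, _, f, prod A B => prod (rename f A) (rename f B)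
  | _, _, _, empty => empty
  | _, _, f, sum A B => sum (rename f A) (rename f B)
  | _, _, f, arr A B => arr (rename f A) (rename f B)
  | _, _, f, mu A => mu (rename (Fin.cons 0 fun k => (f k).succ) A)
  | _, _, f, later A => later (rename f A)
  | _, _, _, box A => box A

/-- Simultaneous capture-avoiding substitution of types for type variables. -/
def subst : {n m : ℕ} → (Fin n → Ty m) → Ty n → Ty m
  | _, _, s, var k => s k
  | _, _, _, nat => nat
  | _, _, _, one => one
  | _, _, s, prod A B => prod (subst s A) (subst s B)
  | _, _, _, empty => empty
  | _, _, s, sum A B => sum (subst s A) (subst s B)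
  | _, _, s, arr A B => arr (subst s A) (subst s B)
  | _, _, s, mu A => mu (subst (Fin.cons (var 0) fun k => rename Fin.succ (s k)) A)
  | _, _, s, later A => later (subst s A)
  | _, _, _, box A => box A

/-- `A[B/α]`, where `α` is the variable `0` of `A`. -/
def inst {n : ℕ} (A : Ty (n + 1)) (B : Ty n) : Ty n := subst (Fin.cons B var) A

/-- The guarded conatural numbers `μα. 1 + ▶α`. Their denotation is the subobject classifier, and
so they serve as the type of propositions. -/
def gCoNat : Ty 0 := mu (sum one (later (var 0)))

theorem gCoNat_wf : gCoNat.WF := by simp [gCoNat, WF, GuardedIn]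

end Ty

/-! ### Untyped terms and their operational semantics -/

/-- Untyped terms with `n` free variables (de Bruijn indices). An explicit substitution with `m`
variables is a family `s : Fin m → Tm n`; in `prev s t`, `box s t` and `boxSum s t` it binds all
`m` free variables of `t`. The symbol `ap` stands for `⊛`. -/
inductive Tm : ℕ → Type
  | var {n : ℕ} (k : Fin n) : Tm n
  | zero {n : ℕ} : Tm n
  | succ {n : ℕ} (t : Tm n) : Tm n
  | unit {n : ℕ} : Tm n
  | pair {n : ℕ} (t u : Tm n) : Tm n
  | fst {n : ℕ} (t : Tm n) : Tm n
  | snd {n : ℕ} (t : Tm n) : Tm n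
  | abort {n : ℕ} (t : Tm n) : Tm n
  | inl {n : ℕ} (t : Tm n) : Tm n
  | inr {n : ℕ} (t : Tm n) : Tm n
  | caseOf {n : ℕ} (t : Tm n) (u₁ u₂ : Tm (n + 1)) : Tm n
  | lam {n : ℕ} (t : Tm (n + 1)) : Tm n
  | app {n : ℕ} (t u : Tm n) : Tm n
  | fold {n : ℕ} (t : Tm n) : Tm n
  | unfold {n : ℕ} (t : Tm n) : Tm n
  | next {n : ℕ} (t : Tm n) : Tm n
  | prev {n m : ℕ} (s : Fin m → Tm n) (t : Tm m) : Tm n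
  | ap {n : ℕ} (t u : Tm n) : Tm n
  | box {n m : ℕ} (s : Fin m → Tm n) (t : Tm m) : Tm n
  | unbox {n : ℕ} (t : Tm n) : Tm n
  | boxSum {n m : ℕ} (s : Fin m → Tm n) (t : Tm m) : Tm n

namespace Tm

/-- Renaming of variables. -/
def rename : {n m : ℕ} → (Fin n → Fin m) → Tm n → Tm m
  | _, _, f, var k => var (f k)
  | _, _, _, zero => zero
  | _, _, f, succ t => succ (rename f t)
  | _, _, _, unit => unit
  | _, _, f, pair t u => pair (rename f t) (rename f u)
  | _, _, f, fst t => fst (rename f t)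
  | _, _, f, snd t => snd (rename f t)
  | _, _, f, abort t => abort (rename f t)
  | _, _, f, inl t => inl (rename f t)
  | _, _, f, inr t => inr (rename f t)
  | _, _, f, caseOf t u₁ u₂ =>
      caseOf (rename f t) (rename (Fin.cons 0 fun k => (f k).succ) u₁)
        (rename (Fin.cons 0 fun k => (f k).succ) u₂)
  | _, _, f, lam t => lam (rename (Fin.cons 0 fun k => (f k).succ) t)
  | _, _, f, app t u => app (rename f t) (rename f u)
  | _, _, f, fold t => fold (rename f t)
  | _, _, f, unfold t => unfold (rename f t)
  | _, _, f, next t => next (rename f t)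
  | _, _, f, prev s t => prev (fun k => rename f (s k)) t
  | _, _, f, ap t u => ap (rename f t) (rename f u)
  | _, _, f, box s t => box (fun k => rename f (s k)) t
  | _, _, f, unbox t => unbox (rename f t)
  | _, _, f, boxSum s t => boxSum (fun k => rename f (s k)) t

/-- The substitution `s`, extended to go under one binder. -/
def lift {n m : ℕ} (s : Fin n → Tm m) : Fin (n + 1) → Tm (m + 1) :=
  Fin.cons (var 0) fun k => rename Fin.succ (s k)

/-- Simultaneous capture-avoiding substitution `t[s]`. -/
def subst : {n m : ℕ} → (Fin n → Tm m) → Tm n → Tm m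
  | _, _, s, var k => s k
  | _, _, _, zero => zero
  | _, _, s, succ t => succ (subst s t)
  | _, _, _, unit => unit
  | _, _, s, pair t u => pair (subst s t) (subst s u)
  | _, _, s, fst t => fst (subst s t)
  | _, _, s, snd t => snd (subst s t)
  | _, _, s, abort t => abort (subst s t)
  | _, _, s, inl t => inl (subst s t)
  | _, _, s, inr t => inr (subst s t)
  | _, _, s, caseOf t u₁ u₂ => caseOf (subst s t) (subst (lift s) u₁) (subst (lift s) u₂)
  | _, _, s, lam t => lam (subst (lift s) t)
  | _, _, s, app t u => app (subst s t) (subst s u)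
  | _, _, s, fold t => fold (subst s t)
  | _, _, s, unfold t => unfold (subst s t)
  | _, _, s, next t => next (subst s t)
  | _, _, s, prev r t => prev (fun k => subst s (r k)) t
  | _, _, s, ap t u => ap (subst s t) (subst s u)
  | _, _, s, box r t => box (fun k => subst s (r k)) t
  | _, _, s, unbox t => unbox (subst s t)
  | _, _, s, boxSum r t => boxSum (fun k => subst s (r k)) t

/-- `t[u/x]`, where `x` is the variable `0` of `t`. -/
def inst {n : ℕ} (t : Tm (n + 1)) (u : Tm n) : Tm n := subst (Fin.cons u var) t

end Tm

/-- The closed terms `succⁿ zero`. -/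
inductive Numeral : Tm 0 → Prop
  | zero : Numeral .zero
  | succ {t : Tm 0} : Numeral t → Numeral (.succ t)

/-- Closed values. -/
inductive Value : Tm 0 → Prop
  | numeral {t : Tm 0} : Numeral t → Value t
  | unit : Value .unit
  | pair (t u : Tm 0) : Value (.pair t u)
  | inl (t : Tm 0) : Value (.inl t)
  | inr (t : Tm 0) : Value (.inr t)
  | lam (t : Tm 1) : Value (.lam t)
  | fold (t : Tm 0) : Value (.fold t)
  | next (t : Tm 0) : Value (.next t)
  | box {m : ℕ} (s : Fin m → Tm 0) (t : Tm m) : Value (.box s t)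

/-- The reduction rules on closed terms. -/
inductive Rule : Tm 0 → Tm 0 → Prop
  | fst (t u : Tm 0) : Rule (.fst (.pair t u)) t
  | snd (t u : Tm 0) : Rule (.snd (.pair t u)) u
  | caseInl (t : Tm 0) (u₁ u₂ : Tm 1) : Rule (.caseOf (.inl t) u₁ u₂) (u₁.inst t)
  | caseInr (t : Tm 0) (u₁ u₂ : Tm 1) : Rule (.caseOf (.inr t) u₁ u₂) (u₂.inst t)
  | beta (t : Tm 1) (u : Tm 0) : Rule (.app (.lam t) u) (t.inst u)
  | unfoldFold (t : Tm 0) : Rule (.unfold (.fold t)) t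
  | prevSubst {m : ℕ} (s : Fin m → Tm 0) (t : Tm m) :
      m ≠ 0 → Rule (.prev s t) (.prev ![] (t.subst s))
  | prevNext (s : Fin 0 → Tm 0) (t : Tm 0) : Rule (.prev s (.next t)) t
  | apNext (t u : Tm 0) : Rule (.ap (.next t) (.next u)) (.next (.app t u))
  | unboxBox {m : ℕ} (s : Fin m → Tm 0) (t : Tm m) : Rule (.unbox (.box s t)) (t.subst s)
  | boxSumSubst {m : ℕ} (s : Fin m → Tm 0) (t : Tm m) :
      m ≠ 0 → Rule (.boxSum s t) (.boxSum ![] (t.subst s))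
  | boxSumInl (s : Fin 0 → Tm 0) (t : Tm 0) : Rule (.boxSum s (.inl t)) (.inl (.box ![] t))
  | boxSumInr (s : Fin 0 → Tm 0) (t : Tm 0) : Rule (.boxSum s (.inr t)) (.inr (.box ![] t))

/-- Call-by-name reduction `E[t] ↦ E[u]`, where `t ↦ u` is a reduction rule and `E` an evaluation
context: the closure of the rules under the formers of evaluation contexts. -/
inductive Step : Tm 0 → Tm 0 → Prop
  | rule {t u : Tm 0} : Rule t u → Step t u
  | succ {t u : Tm 0} : Step t u → Step (.succ t) (.succ u)
  | fst {t u : Tm 0} : Step t u → Step (.fst t) (.fst u)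
  | snd {t u : Tm 0} : Step t u → Step (.snd t) (.snd u)
  | caseOf {t u : Tm 0} (v₁ v₂ : Tm 1) : Step t u → Step (.caseOf t v₁ v₂) (.caseOf u v₁ v₂)
  | app {t u : Tm 0} (v : Tm 0) : Step t u → Step (.app t v) (.app u v)
  | unfold {t u : Tm 0} : Step t u → Step (.unfold t) (.unfold u)
  | prev {t u : Tm 0} (s : Fin 0 → Tm 0) : Step t u → Step (.prev s t) (.prev s u)
  | apLeft {t u : Tm 0} (v : Tm 0) : Step t u → Step (.ap t v) (.ap u v)
  | apRight {t u v : Tm 0} : Value v → Step t u → Step (.ap v t) (.ap v u)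
  | unbox {t u : Tm 0} : Step t u → Step (.unbox t) (.unbox u)
  | boxSum {t u : Tm 0} (s : Fin 0 → Tm 0) : Step t u → Step (.boxSum s t) (.boxSum s u)

/-- The reflexive transitive closure of call-by-name reduction. -/
def Reduces : Tm 0 → Tm 0 → Prop := Relation.ReflTransGen Step

/-! ### Typing -/

/-- Typing contexts with `n` variables. -/
abbrev Ctx (n : ℕ) : Type := Fin n → Ty 0

/-- The context `Γ, x : A`; the new variable has index `0`. -/
abbrev Ctx.ext {n : ℕ} (A : Ty 0) (Γ : Ctx n) : Ctx (n + 1) := Fin.cons A Γ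

/-- Typing derivations of `Γ ⊢ t : A`. The side conditions `WF` record that all types which occur
in a derivation are well formed. -/
inductive HasType : {n : ℕ} → Ctx n → Tm n → Ty 0 → Type
  | var {n : ℕ} {Γ : Ctx n} (k : Fin n) : HasType Γ (.var k) (Γ k)
  | zero {n : ℕ} {Γ : Ctx n} : HasType Γ .zero .nat
  | succ {n : ℕ} {Γ : Ctx n} {t : Tm n} : HasType Γ t .nat → HasType Γ (.succ t) .nat
  | unit {n : ℕ} {Γ : Ctx n} : HasType Γ .unit .one
  | pair {n : ℕ} {Γ : Ctx n} {t u : Tm n} {A B : Ty 0} :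
      HasType Γ t A → HasType Γ u B → HasType Γ (.pair t u) (.prod A B)
  | fst {n : ℕ} {Γ : Ctx n} {t : Tm n} {A B : Ty 0} :
      HasType Γ t (.prod A B) → HasType Γ (.fst t) A
  | snd {n : ℕ} {Γ : Ctx n} {t : Tm n} {A B : Ty 0} :
      HasType Γ t (.prod A B) → HasType Γ (.snd t) B
  | abort {n : ℕ} {Γ : Ctx n} {t : Tm n} {A : Ty 0} :
      A.WF → HasType Γ t .empty → HasType Γ (.abort t) A
  | inl {n : ℕ} {Γ : Ctx n} {t : Tm n} {A B : Ty 0} :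
      B.WF → HasType Γ t A → HasType Γ (.inl t) (.sum A B)
  | inr {n : ℕ} {Γ : Ctx n} {t : Tm n} {A B : Ty 0} :
      A.WF → HasType Γ t B → HasType Γ (.inr t) (.sum A B)
  | caseOf {n : ℕ} {Γ : Ctx n} {t : Tm n} {u₁ u₂ : Tm (n + 1)} {A B C : Ty 0} :
      HasType Γ t (.sum A B) → HasType (Ctx.ext A Γ) u₁ C → HasType (Ctx.ext B Γ) u₂ C →
      HasType Γ (.caseOf t u₁ u₂) C
  | lam {n : ℕ} {Γ : Ctx n} {t : Tm (n + 1)} {A B : Ty 0} :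
      A.WF → HasType (Ctx.ext A Γ) t B → HasType Γ (.lam t) (.arr A B)
  | app {n : ℕ} {Γ : Ctx n} {t u : Tm n} {A B : Ty 0} :
      HasType Γ t (.arr A B) → HasType Γ u A → HasType Γ (.app t u) B
  | fold {n : ℕ} {Γ : Ctx n} {t : Tm n} {A : Ty 1} :
      (Ty.mu A).WF → HasType Γ t (A.inst (.mu A)) → HasType Γ (.fold t) (.mu A)
  | unfold {n : ℕ} {Γ : Ctx n} {t : Tm n} {A : Ty 1} :
      (Ty.mu A).WF → HasType Γ t (.mu A) → HasType Γ (.unfold t) (A.inst (.mu A))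
  | next {n : ℕ} {Γ : Ctx n} {t : Tm n} {A : Ty 0} :
      HasType Γ t A → HasType Γ (.next t) (.later A)
  | prev {n m : ℕ} {Γ : Ctx n} {Δ : Ctx m} {s : Fin m → Tm n} {t : Tm m} {A : Ty 0} :
      (∀ k, (Δ k).WF) → (∀ k, (Δ k).Constant) →
      HasType Δ t (.later A) → (∀ k, HasType Γ (s k) (Δ k)) → HasType Γ (.prev s t) A
  | ap {n : ℕ} {Γ : Ctx n} {t u : Tm n} {A B : Ty 0} :
      HasType Γ t (.later (.arr A B)) → HasType Γ u (.later A) →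
      HasType Γ (.ap t u) (.later B)
  | box {n m : ℕ} {Γ : Ctx n} {Δ : Ctx m} {s : Fin m → Tm n} {t : Tm m} {A : Ty 0} :
      (∀ k, (Δ k).WF) → (∀ k, (Δ k).Constant) →
      HasType Δ t A → (∀ k, HasType Γ (s k) (Δ k)) → HasType Γ (.box s t) (.box A)
  | unbox {n : ℕ} {Γ : Ctx n} {t : Tm n} {A : Ty 0} :
      HasType Γ t (.box A) → HasType Γ (.unbox t) A
  | boxSum {n m : ℕ} {Γ : Ctx n} {Δ : Ctx m} {s : Fin m → Tm n} {t : Tm m} {A B : Ty 0} :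
      (∀ k, (Δ k).WF) → (∀ k, (Δ k).Constant) →
      HasType Δ t (.sum A B) → (∀ k, HasType Γ (s k) (Δ k)) →
      HasType Γ (.boxSum s t) (.sum (.box A) (.box B))

/-! ### Contextual equivalence -/

/-- `Cx h n`: term contexts with `n` free variables and one hole, to be filled by a term with `h`
free variables (filling the hole may capture variables). In `prevSubst s k C t` the hole is in the
`k`-th term of the explicit substitution, and the term `s k` is ignored; similarly for `boxSubst`
and `boxSumSubst`. -/
inductive Cx (h : ℕ) : ℕ → Type
  | hole : Cx h h
  | succ {n : ℕ} (C : Cx h n) : Cx h n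
  | pairLeft {n : ℕ} (C : Cx h n) (u : Tm n) : Cx h n
  | pairRight {n : ℕ} (t : Tm n) (C : Cx h n) : Cx h n
  | fst {n : ℕ} (C : Cx h n) : Cx h n
  | snd {n : ℕ} (C : Cx h n) : Cx h n
  | abort {n : ℕ} (C : Cx h n) : Cx h n
  | inl {n : ℕ} (C : Cx h n) : Cx h n
  | inr {n : ℕ} (C : Cx h n) : Cx h n
  | caseScrut {n : ℕ} (C : Cx h n) (u₁ u₂ : Tm (n + 1)) : Cx h n
  | caseLeft {n : ℕ} (t : Tm n) (C : Cx h (n + 1)) (u₂ : Tm (n + 1)) : Cx h n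
  | caseRight {n : ℕ} (t : Tm n) (u₁ : Tm (n + 1)) (C : Cx h (n + 1)) : Cx h n
  | lam {n : ℕ} (C : Cx h (n + 1)) : Cx h n
  | appLeft {n : ℕ} (C : Cx h n) (u : Tm n) : Cx h n
  | appRight {n : ℕ} (t : Tm n) (C : Cx h n) : Cx h n
  | fold {n : ℕ} (C : Cx h n) : Cx h n
  | unfold {n : ℕ} (C : Cx h n) : Cx h n
  | next {n : ℕ} (C : Cx h n) : Cx h n
  | prevSubst {n m : ℕ} (s : Fin m → Tm n) (k : Fin m) (C : Cx h n) (t : Tm m) : Cx h n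
  | prevBody {n m : ℕ} (s : Fin m → Tm n) (C : Cx h m) : Cx h n
  | apLeft {n : ℕ} (C : Cx h n) (u : Tm n) : Cx h n
  | apRight {n : ℕ} (t : Tm n) (C : Cx h n) : Cx h n
  | boxSubst {n m : ℕ} (s : Fin m → Tm n) (k : Fin m) (C : Cx h n) (t : Tm m) : Cx h n
  | boxBody {n m : ℕ} (s : Fin m → Tm n) (C : Cx h m) : Cx h n
  | unbox {n : ℕ} (C : Cx h n) : Cx h n
  | boxSumSubst {n m : ℕ} (s : Fin m → Tm n) (k : Fin m) (C : Cx h n) (t : Tm m) : Cx h n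
  | boxSumBody {n m : ℕ} (s : Fin m → Tm n) (C : Cx h m) : Cx h n

/-- `C.plug t` is `C[t]`. -/
def Cx.plug {h : ℕ} : {n : ℕ} → Cx h n → Tm h → Tm n
  | _, hole, t => t
  | _, succ C, t => .succ (C.plug t)
  | _, pairLeft C u, t => .pair (C.plug t) u
  | _, pairRight u C, t => .pair u (C.plug t)
  | _, fst C, t => .fst (C.plug t)
  | _, snd C, t => .snd (C.plug t)
  | _, abort C, t => .abort (C.plug t)
  | _, inl C, t => .inl (C.plug t)
  | _, inr C, t => .inr (C.plug t)
  | _, caseScrut C u₁ u₂, t => .caseOf (C.plug t) u₁ u₂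
  | _, caseLeft u C u₂, t => .caseOf u (C.plug t) u₂
  | _, caseRight u u₁ C, t => .caseOf u u₁ (C.plug t)
  | _, lam C, t => .lam (C.plug t)
  | _, appLeft C u, t => .app (C.plug t) u
  | _, appRight u C, t => .app u (C.plug t)
  | _, fold C, t => .fold (C.plug t)
  | _, unfold C, t => .unfold (C.plug t)
  | _, next C, t => .next (C.plug t)
  | _, prevSubst s k C u, t => .prev (Function.update s k (C.plug t)) u
  | _, prevBody s C, t => .prev s (C.plug t)
  | _, apLeft C u, t => .ap (C.plug t) u
  | _, apRight u C, t => .ap u (C.plug t)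
  | _, boxSubst s k C u, t => .box (Function.update s k (C.plug t)) u
  | _, boxBody s C, t => .box s (C.plug t)
  | _, unbox C, t => .unbox (C.plug t)
  | _, boxSumSubst s k C u, t => .boxSum (Function.update s k (C.plug t)) u
  | _, boxSumBody s C, t => .boxSum s (C.plug t)

/-- `CxType Γ₀ A₀ Γ C A`: when the hole of `C` is taken to be a term of type `A₀` in context `Γ₀`,
then `C` has type `A` in context `Γ`. -/
inductive CxType {h : ℕ} (Γ₀ : Ctx h) (A₀ : Ty 0) : {n : ℕ} → Ctx n → Cx h n → Ty 0 → Prop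
  | hole : CxType Γ₀ A₀ Γ₀ .hole A₀
  | succ {n : ℕ} {Γ : Ctx n} {C : Cx h n} :
      CxType Γ₀ A₀ Γ C .nat → CxType Γ₀ A₀ Γ (.succ C) .nat
  | pairLeft {n : ℕ} {Γ : Ctx n} {C : Cx h n} {u : Tm n} {A B : Ty 0} :
      CxType Γ₀ A₀ Γ C A → HasType Γ u B → CxType Γ₀ A₀ Γ (.pairLeft C u) (.prod A B)
  | pairRight {n : ℕ} {Γ : Ctx n} {t : Tm n} {C : Cx h n} {A B : Ty 0} :
      HasType Γ t A → CxType Γ₀ A₀ Γ C B → CxType Γ₀ A₀ Γ (.pairRight t C) (.prod A B)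
  | fst {n : ℕ} {Γ : Ctx n} {C : Cx h n} {A B : Ty 0} :
      CxType Γ₀ A₀ Γ C (.prod A B) → CxType Γ₀ A₀ Γ (.fst C) A
  | snd {n : ℕ} {Γ : Ctx n} {C : Cx h n} {A B : Ty 0} :
      CxType Γ₀ A₀ Γ C (.prod A B) → CxType Γ₀ A₀ Γ (.snd C) B
  | abort {n : ℕ} {Γ : Ctx n} {C : Cx h n} {A : Ty 0} :
      A.WF → CxType Γ₀ A₀ Γ C .empty → CxType Γ₀ A₀ Γ (.abort C) A
  | inl {n : ℕ} {Γ : Ctx n} {C : Cx h n} {A B : Ty 0} :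
      B.WF → CxType Γ₀ A₀ Γ C A → CxType Γ₀ A₀ Γ (.inl C) (.sum A B)
  | inr {n : ℕ} {Γ : Ctx n} {C : Cx h n} {A B : Ty 0} :
      A.WF → CxType Γ₀ A₀ Γ C B → CxType Γ₀ A₀ Γ (.inr C) (.sum A B)
  | caseScrut {n : ℕ} {Γ : Ctx n} {C : Cx h n} {u₁ u₂ : Tm (n + 1)} {A B D : Ty 0} :
      CxType Γ₀ A₀ Γ C (.sum A B) → HasType (Ctx.ext A Γ) u₁ D → HasType (Ctx.ext B Γ) u₂ D →
      CxType Γ₀ A₀ Γ (.caseScrut C u₁ u₂) D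
  | caseLeft {n : ℕ} {Γ : Ctx n} {t : Tm n} {C : Cx h (n + 1)} {u₂ : Tm (n + 1)}
      {A B D : Ty 0} :
      HasType Γ t (.sum A B) → CxType Γ₀ A₀ (Ctx.ext A Γ) C D → HasType (Ctx.ext B Γ) u₂ D →
      CxType Γ₀ A₀ Γ (.caseLeft t C u₂) D
  | caseRight {n : ℕ} {Γ : Ctx n} {t : Tm n} {u₁ : Tm (n + 1)} {C : Cx h (n + 1)}
      {A B D : Ty 0} :
      HasType Γ t (.sum A B) → HasType (Ctx.ext A Γ) u₁ D → CxType Γ₀ A₀ (Ctx.ext B Γ) C D →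
      CxType Γ₀ A₀ Γ (.caseRight t u₁ C) D
  | lam {n : ℕ} {Γ : Ctx n} {C : Cx h (n + 1)} {A B : Ty 0} :
      A.WF → CxType Γ₀ A₀ (Ctx.ext A Γ) C B → CxType Γ₀ A₀ Γ (.lam C) (.arr A B)
  | appLeft {n : ℕ} {Γ : Ctx n} {C : Cx h n} {u : Tm n} {A B : Ty 0} :
      CxType Γ₀ A₀ Γ C (.arr A B) → HasType Γ u A → CxType Γ₀ A₀ Γ (.appLeft C u) B
  | appRight {n : ℕ} {Γ : Ctx n} {t : Tm n} {C : Cx h n} {A B : Ty 0} :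
      HasType Γ t (.arr A B) → CxType Γ₀ A₀ Γ C A → CxType Γ₀ A₀ Γ (.appRight t C) B
  | fold {n : ℕ} {Γ : Ctx n} {C : Cx h n} {A : Ty 1} :
      (Ty.mu A).WF → CxType Γ₀ A₀ Γ C (A.inst (.mu A)) → CxType Γ₀ A₀ Γ (.fold C) (.mu A)
  | unfold {n : ℕ} {Γ : Ctx n} {C : Cx h n} {A : Ty 1} :
      (Ty.mu A).WF → CxType Γ₀ A₀ Γ C (.mu A) → CxType Γ₀ A₀ Γ (.unfold C) (A.inst (.mu A))
  | next {n : ℕ} {Γ : Ctx n} {C : Cx h n} {A : Ty 0} :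
      CxType Γ₀ A₀ Γ C A → CxType Γ₀ A₀ Γ (.next C) (.later A)
  | prevSubst {n m : ℕ} {Γ : Ctx n} {Δ : Ctx m} {s : Fin m → Tm n} {k : Fin m} {C : Cx h n}
      {t : Tm m} {A : Ty 0} :
      (∀ j, (Δ j).WF) → (∀ j, (Δ j).Constant) → HasType Δ t (.later A) →
      (∀ j, j ≠ k → HasType Γ (s j) (Δ j)) → CxType Γ₀ A₀ Γ C (Δ k) →
      CxType Γ₀ A₀ Γ (.prevSubst s k C t) A
  | prevBody {n m : ℕ} {Γ : Ctx n} {Δ : Ctx m} {s : Fin m → Tm n} {C : Cx h m} {A : Ty 0} :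
      (∀ j, (Δ j).WF) → (∀ j, (Δ j).Constant) → CxType Γ₀ A₀ Δ C (.later A) →
      (∀ j, HasType Γ (s j) (Δ j)) → CxType Γ₀ A₀ Γ (.prevBody s C) A
  | apLeft {n : ℕ} {Γ : Ctx n} {C : Cx h n} {u : Tm n} {A B : Ty 0} :
      CxType Γ₀ A₀ Γ C (.later (.arr A B)) → HasType Γ u (.later A) →
      CxType Γ₀ A₀ Γ (.apLeft C u) (.later B)
  | apRight {n : ℕ} {Γ : Ctx n} {t : Tm n} {C : Cx h n} {A B : Ty 0} :
      HasType Γ t (.later (.arr A B)) → CxType Γ₀ A₀ Γ C (.later A) →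
      CxType Γ₀ A₀ Γ (.apRight t C) (.later B)
  | boxSubst {n m : ℕ} {Γ : Ctx n} {Δ : Ctx m} {s : Fin m → Tm n} {k : Fin m} {C : Cx h n}
      {t : Tm m} {A : Ty 0} :
      (∀ j, (Δ j).WF) → (∀ j, (Δ j).Constant) → HasType Δ t A →
      (∀ j, j ≠ k → HasType Γ (s j) (Δ j)) → CxType Γ₀ A₀ Γ C (Δ k) →
      CxType Γ₀ A₀ Γ (.boxSubst s k C t) (.box A)
  | boxBody {n m : ℕ} {Γ : Ctx n} {Δ : Ctx m} {s : Fin m → Tm n} {C : Cx h m} {A : Ty 0} :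
      (∀ j, (Δ j).WF) → (∀ j, (Δ j).Constant) → CxType Γ₀ A₀ Δ C A →
      (∀ j, HasType Γ (s j) (Δ j)) → CxType Γ₀ A₀ Γ (.boxBody s C) (.box A)
  | unbox {n : ℕ} {Γ : Ctx n} {C : Cx h n} {A : Ty 0} :
      CxType Γ₀ A₀ Γ C (.box A) → CxType Γ₀ A₀ Γ (.unbox C) A
  | boxSumSubst {n m : ℕ} {Γ : Ctx n} {Δ : Ctx m} {s : Fin m → Tm n} {k : Fin m}
      {C : Cx h n} {t : Tm m} {A B : Ty 0} :
      (∀ j, (Δ j).WF) → (∀ j, (Δ j).Constant) → HasType Δ t (.sum A B) →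
      (∀ j, j ≠ k → HasType Γ (s j) (Δ j)) → CxType Γ₀ A₀ Γ C (Δ k) →
      CxType Γ₀ A₀ Γ (.boxSumSubst s k C t) (.sum (.box A) (.box B))
  | boxSumBody {n m : ℕ} {Γ : Ctx n} {Δ : Ctx m} {s : Fin m → Tm n} {C : Cx h m}
      {A B : Ty 0} :
      (∀ j, (Δ j).WF) → (∀ j, (Δ j).Constant) → CxType Γ₀ A₀ Δ C (.sum A B) →
      (∀ j, HasType Γ (s j) (Δ j)) →
      CxType Γ₀ A₀ Γ (.boxSumBody s C) (.sum (.box A) (.box B))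

/-- Contextual equivalence of two terms of type `A` in context `Γ`: in every well-typed closing
context of type `nat` they reduce to the same value. -/
def CtxEquiv {n : ℕ} (Γ : Ctx n) (A : Ty 0) (t u : Tm n) : Prop :=
  ∀ C : Cx n 0, CxType Γ A ![] C .nat →
    ∃ v : Tm 0, Value v ∧ Reduces (C.plug t) v ∧ Reduces (C.plug u) v

/-! ### The topos of trees -/

/-- Objects of the topos of trees. Stages are numbered from `0` here. -/
@[ext]
structure Obj : Type 1 where
  el : ℕ → Type
  res : ∀ i, el (i + 1) → el i

/-- Arrows of the topos of trees. -/
@[ext]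
structure Hom (X Y : Obj) : Type where
  app : ∀ i, X.el i → Y.el i
  nat : ∀ i x, app i (X.res i x) = Y.res i (app (i + 1) x)

namespace Obj

/-- The composed restriction function from stage `i` to stage `j ≤ i`. -/
def restr (X : Obj) {i j : ℕ} (h : j ≤ i) (x : X.el i) : X.el j :=
  Nat.decreasingInduction (motive := fun k _ => X.el k) (fun k _ y => X.res k y) x h

theorem restr_self (X : Obj) {i : ℕ} (x : X.el i) : X.restr le_rfl x = x := by
  simp [restr]

theorem restr_succ (X : Obj) {i j : ℕ} (h : j + 1 ≤ i) (x : X.el i) :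
    X.restr (Nat.le_of_succ_le h) x = X.res j (X.restr h x) := by
  unfold restr
  rw [Nat.decreasingInduction_succ_left]

theorem restr_res (X : Obj) {i j : ℕ} (h : j ≤ i) (x : X.el (i + 1)) :
    X.restr (Nat.le_succ_of_le h) x = X.restr h (X.res i x) := by
  induction h using Nat.decreasingInduction with
  | self => rw [restr_succ X le_rfl, restr_self, restr_self]
  | of_succ k h ih =>
    rw [restr_succ X (Nat.succ_le_succ (Nat.le_of_lt h)), restr_succ X h, ← ih]

/-- The constant object on a set. -/
abbrev const (Z : Type) : Obj := ⟨fun _ => Z, fun _ z => z⟩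

/-- Binary products, computed pointwise. -/
abbrev prod (X Y : Obj) : Obj := ⟨fun i => X.el i × Y.el i, fun i p => (X.res i p.1, Y.res i p.2)⟩

/-- Binary coproducts, computed pointwise. -/
abbrev sum (X Y : Obj) : Obj := ⟨fun i => X.el i ⊕ Y.el i, fun i => Sum.map (X.res i) (Y.res i)⟩

/-- The exponential `Y ^ X`: at stage `i`, tuples of functions `X_j → Y_j` for `j ≤ i` that commute
with restriction. -/
abbrev exp (X Y : Obj) : Obj where
  el i := { f : ∀ j : Fin (i + 1), X.el j → Y.el j //
    ∀ (j : Fin i) (x : X.el (j + 1)), f j.castSucc (X.res j x) = Y.res j (f j.succ x) }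
  res _ f := ⟨fun j => f.1 j.castSucc, fun j x => f.2 j.castSucc x⟩

/-- The object `▶X`: a singleton, followed by the stages of `X`. -/
def later (X : Obj) : Obj where
  el := fun | 0 => Unit | i + 1 => X.el i
  res := fun | 0 => fun _ => () | i + 1 => X.res i

/-- Global elements `1 → X`. -/
abbrev Global (X : Obj) : Type := { a : ∀ i, X.el i // ∀ i, X.res i (a (i + 1)) = a i }

/-- The object `■X`: the constant object on the set of global elements of `X`. -/
abbrev box (X : Obj) : Obj := const X.Global

/-- The product of a finite family. -/
abbrev pi {n : ℕ} (X : Fin n → Obj) : Obj := ⟨fun i => ∀ k, (X k).el i, fun i x k => (X k).res i (x k)⟩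

/-- An object with `F X = X`, if there is one. For the locally contractive operations that guarded
types denote there is exactly one such object (see `Ty.den_mu`), and it is a choice of the object,
unique up to isomorphism, with `F X ≅ X`. -/
noncomputable def fix (F : Obj → Obj) : Obj :=
  open Classical in if h : ∃ X, F X = X then h.choose else const Unit

end Obj

/-- The denotation of an open type, given objects for its free type variables. (The mixed-variance
functor that a type denotes is evaluated here at tuples that give the same object to the negative
and the positive occurrences of each variable; only these matter for the denotation of closed
types.) -/
noncomputable def Ty.den : {n : ℕ} → Ty n → (Fin n → Obj) → Obj
  | _, var k, r => r k
  | _, nat, _ => .const ℕ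
  | _, one, _ => .const Unit
  | _, prod A B, r => .prod (den A r) (den B r)
  | _, empty, _ => .const Empty
  | _, sum A B, r => .sum (den A r) (den B r)
  | _, arr A B, r => .exp (den A r) (den B r)
  | _, mu A, r => .fix fun X => den A (Fin.cons X r)
  | _, later A, r => .later (den A r)
  | _, box A, _ => .box (den A ![])

/-- The denotation of a closed type. -/
noncomputable abbrev Ty.obj (A : Ty 0) : Obj := A.den ![]

/-- The denotation of a typing context. -/
noncomputable def Ctx.obj {n : ℕ} (Γ : Ctx n) : Obj := .pi fun k => (Γ k).obj

/-! ### Recursive types denote fixed points -/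

namespace Obj

/-- The part of an object up to stage `n`. -/
def tr (n : ℕ) (X : Obj) :
    Σ a : Fin (n + 1) → Type, ∀ j : Fin n, a j.succ → a j.castSucc :=
  ⟨fun j => X.el j, fun j => X.res j⟩

/-- The objects `X` and `Y` agree at all stages below `n`. -/
def Agree : ℕ → Obj → Obj → Prop
  | 0, _, _ => True
  | n + 1, X, Y => tr n X = tr n Y

theorem tr_ext {n : ℕ} {X Y : Obj} (h : ∀ j ≤ n, X.el j = Y.el j)
    (h' : ∀ j < n, HEq (X.res j) (Y.res j)) : tr n X = tr n Y := by
  refine Sigma.ext (funext fun j => h j (Nat.lt_succ_iff.mp j.2)) ?_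
  exact Function.hfunext rfl fun a b hab => by
    obtain rfl := eq_of_heq hab
    exact h' a a.2

theorem tr_el {n : ℕ} {X Y : Obj} (h : tr n X = tr n Y) {j : ℕ} (hj : j ≤ n) :
    X.el j = Y.el j :=
  congrFun (congrArg Sigma.fst h) ⟨j, Nat.lt_succ_iff.mpr hj⟩

theorem tr_res {n : ℕ} {X Y : Obj} (h : tr n X = tr n Y) {j : ℕ} (hj : j < n) :
    HEq (X.res j) (Y.res j) := by
  have key : ∀ {S T : Σ a : Fin (n + 1) → Type, ∀ j : Fin n, a j.succ → a j.castSucc},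
      S = T → HEq (S.2 ⟨j, hj⟩) (T.2 ⟨j, hj⟩) := by
    rintro S T rfl
    rfl
  exact key h

theorem agree_iff {n : ℕ} {X Y : Obj} : Agree n X Y ↔
    (∀ j < n, X.el j = Y.el j) ∧ ∀ j, j + 1 < n → HEq (X.res j) (Y.res j) := by
  cases n with
  | zero => simp [Agree]
  | succ n =>
    constructor
    · intro h
      exact ⟨fun j hj => tr_el h (Nat.lt_succ_iff.mp hj),
        fun j hj => tr_res h (Nat.lt_of_succ_lt_succ hj)⟩
    · rintro ⟨h, h'⟩
      exact tr_ext (fun j hj => h j (Nat.lt_succ_iff.mpr hj))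
        fun j hj => h' j (Nat.succ_lt_succ hj)

theorem Agree.mono {m n : ℕ} (hmn : m ≤ n) {X Y : Obj} (h : Agree n X Y) : Agree m X Y := by
  rw [agree_iff] at h ⊢
  exact ⟨fun j hj => h.1 j (by lia), fun j hj => h.2 j (by lia)⟩

theorem Agree.refl (n : ℕ) (X : Obj) : Agree n X X := by
  cases n <;> simp [Agree]

theorem Agree.symm {n : ℕ} {X Y : Obj} (h : Agree n X Y) : Agree n Y X := by
  cases n with
  | zero => trivial
  | succ n => exact Eq.symm (show tr n X = tr n Y from h)

theorem Agree.trans {n : ℕ} {X Y Z : Obj} (h : Agree n X Y) (h' : Agree n Y Z) :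
    Agree n X Z := by
  cases n with
  | zero => trivial
  | succ n => exact Eq.trans (show tr n X = tr n Y from h) h'

theorem eq_of_agree {X Y : Obj} (h : ∀ n, Agree n X Y) : X = Y := by
  refine Obj.ext (funext fun i => (agree_iff.mp (h (i + 1))).1 i (Nat.lt_succ_self i)) ?_
  exact Function.hfunext rfl fun a b hab => by
    obtain rfl := eq_of_heq hab
    exact (agree_iff.mp (h (a + 2))).2 a (by lia)

theorem agree_prod {n : ℕ} {X X' Y Y' : Obj} (h : Agree n X X') (h' : Agree n Y Y') :
    Agree n (prod X Y) (prod X' Y') := by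
  cases n with
  | zero => trivial
  | succ n =>
    let G : (S T : Σ a : Fin (n + 1) → Type, ∀ j : Fin n, a j.succ → a j.castSucc) →
        Σ a : Fin (n + 1) → Type, ∀ j : Fin n, a j.succ → a j.castSucc :=
      fun S T => ⟨fun j => S.1 j × T.1 j, fun j p => (S.2 j p.1, T.2 j p.2)⟩
    exact congrArg₂ G h h'

theorem agree_sum {n : ℕ} {X X' Y Y' : Obj} (h : Agree n X X') (h' : Agree n Y Y') :
    Agree n (sum X Y) (sum X' Y') := by
  cases n with
  | zero => trivial
  | succ n =>
    let G : (S T : Σ a : Fin (n + 1) → Type, ∀ j : Fin n, a j.succ → a j.castSucc) →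
        Σ a : Fin (n + 1) → Type, ∀ j : Fin n, a j.succ → a j.castSucc :=
      fun S T => ⟨fun j => S.1 j ⊕ T.1 j, fun j => Sum.map (S.2 j) (T.2 j)⟩
    exact congrArg₂ G h h'

theorem agree_exp {n : ℕ} {X X' Y Y' : Obj} (h : Agree n X X') (h' : Agree n Y Y') :
    Agree n (exp X Y) (exp X' Y') := by
  cases n with
  | zero => trivial
  | succ n =>
    let G : (S T : Σ a : Fin (n + 1) → Type, ∀ j : Fin n, a j.succ → a j.castSucc) →
        Σ a : Fin (n + 1) → Type, ∀ j : Fin n, a j.succ → a j.castSucc :=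
      fun S T => ⟨fun i => { f : ∀ j : Fin (i + 1), S.1 ⟨j, by lia⟩ → T.1 ⟨j, by lia⟩ //
          ∀ (j : Fin i) (x : S.1 ⟨j + 1, by lia⟩),
            f j.castSucc (S.2 ⟨j, by lia⟩ x) = T.2 ⟨j, by lia⟩ (f j.succ x) },
        fun i f => ⟨fun j => f.1 j.castSucc, fun j x => f.2 j.castSucc x⟩⟩
    exact congrArg₂ G h h'

theorem agree_later {n : ℕ} {X X' : Obj} (h : Agree n X X') :
    Agree (n + 1) (later X) (later X') := by
  rw [agree_iff] at h ⊢
  constructor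
  · rintro (_ | j) hj
    · rfl
    · exact h.1 j (by lia)
  · rintro (_ | j) hj
    · have h0 := h.1 0 (by lia)
      change HEq (fun _ : X.el 0 => ()) (fun _ : X'.el 0 => ())
      rw [h0]
    · exact h.2 j (by lia)

/-- The iterates `F (F (… 1))`. -/
def iter (F : Obj → Obj) : ℕ → Obj
  | 0 => const Unit
  | k + 1 => F (iter F k)

theorem exists_fixed {F : Obj → Obj} (hF : ∀ n X Y, Agree n X Y → Agree (n + 1) (F X) (F Y)) :
    ∃ X, F X = X := by
  have h1 : ∀ k, Agree k (iter F k) (iter F (k + 1)) := by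
    intro k
    induction k with
    | zero => trivial
    | succ k ih => exact hF k _ _ ih
  have h2 : ∀ k m, Agree k (iter F k) (iter F (k + m)) := by
    intro k m
    induction m with
    | zero => exact Agree.refl _ _
    | succ m ih => exact ih.trans ((h1 (k + m)).mono (Nat.le_add_right k m))
  have hel : ∀ i m, (iter F (i + 1)).el i = (iter F (i + 1 + m)).el i := fun i m =>
    (agree_iff.mp (h2 (i + 1) m)).1 i (Nat.lt_succ_self i)
  let L : Obj := ⟨fun i => (iter F (i + 1)).el i,
    fun i x => cast (hel i 1).symm ((iter F (i + 2)).res i x)⟩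
  have hL : ∀ k, Agree k L (iter F k) := by
    intro k
    rw [agree_iff]
    constructor
    · intro j hj
      obtain ⟨m, rfl⟩ := Nat.exists_eq_add_of_le (show j + 1 ≤ k from hj)
      exact hel j m
    · intro j hj
      obtain ⟨m, rfl⟩ := Nat.exists_eq_add_of_le (show j + 2 ≤ k from hj)
      have h3 : HEq ((iter F (j + 2)).res j) ((iter F (j + 2 + m)).res j) :=
        (agree_iff.mp (h2 (j + 2) m)).2 j (by lia)
      refine HEq.trans ?_ h3
      refine Function.hfunext rfl fun a b hab => ?_
      obtain rfl := eq_of_heq hab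
      exact cast_heq _ _
  refine ⟨L, eq_of_agree fun n => ?_⟩
  cases n with
  | zero => trivial
  | succ n => exact (hF n _ _ (hL n)).trans (hL (n + 1)).symm

theorem fix_eq {F : Obj → Obj} (h : ∃ X, F X = X) : F (fix F) = fix F := by
  unfold fix
  rw [dif_pos h]
  exact h.choose_spec

end Obj

namespace Ty

/-- Local contractiveness: the denotation of `A` below stage `n + 1` depends only on the stages
below `n` of the objects for guarded variables. -/
theorem den_agree {N : ℕ} (A : Ty N) (hA : A.WF) (n : ℕ) (r r' : Fin N → Obj)
    (h : ∀ k, Obj.Agree n (r k) (r' k))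
    (h' : ∀ k, ¬ GuardedIn k A → Obj.Agree (n + 1) (r k) (r' k)) :
    Obj.Agree (n + 1) (A.den r) (A.den r') := by
  induction A generalizing n with
  | var k => exact h' k (by simp [GuardedIn])
  | nat => exact Obj.Agree.refl _ _
  | one => exact Obj.Agree.refl _ _
  | prod A B ihA ihB =>
    exact Obj.agree_prod (ihA hA.1 n r r' h fun k hk => h' k fun hg => hk hg.1)
      (ihB hA.2 n r r' h fun k hk => h' k fun hg => hk hg.2)
  | empty => exact Obj.Agree.refl _ _
  | sum A B ihA ihB =>
    exact Obj.agree_sum (ihA hA.1 n r r' h fun k hk => h' k fun hg => hk hg.1)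
      (ihB hA.2 n r r' h fun k hk => h' k fun hg => hk hg.2)
  | arr A B ihA ihB =>
    exact Obj.agree_exp (ihA hA.1 n r r' h fun k hk => h' k fun hg => hk hg.1)
      (ihB hA.2 n r r' h fun k hk => h' k fun hg => hk hg.2)
  | mu A ih =>
    have hc : ∀ r : Fin _ → Obj, ∃ X, A.den (Fin.cons X r) = X := fun r =>
      Obj.exists_fixed fun m X Y hXY => ih hA.2 m _ _
        (fun k => by
          cases k using Fin.cases with
          | zero => exact hXY
          | succ k => exact Obj.Agree.refl _ _)
        (fun k hk => by
          cases k using Fin.cases with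
          | zero => exact absurd hA.1 hk
          | succ k => exact Obj.Agree.refl _ _)
    have e := Obj.fix_eq (hc r)
    have e' := Obj.fix_eq (hc r')
    change Obj.Agree (n + 1) (Obj.fix _) (Obj.fix _)
    have key : ∀ m ≤ n + 1, Obj.Agree m (Obj.fix fun X => A.den (Fin.cons X r))
        (Obj.fix fun X => A.den (Fin.cons X r')) := by
      intro m
      induction m with
      | zero => intro _; trivial
      | succ m ihm =>
        intro hm
        rw [← e, ← e']
        refine ih hA.2 m _ _ (fun k => ?_) (fun k hk => ?_)
        · cases k using Fin.cases with
          | zero => exact ihm (by lia)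
          | succ k => exact (h k).mono (by lia)
        · cases k using Fin.cases with
          | zero => exact absurd hA.1 hk
          | succ k => exact (h' k hk).mono (by lia)
    exact key _ le_rfl
  | later A ih =>
    refine Obj.agree_later ?_
    cases n with
    | zero => trivial
    | succ n => exact ih hA n r r' (fun k => (h k).mono (by lia)) fun k _ => h k
  | box A ih => exact Obj.Agree.refl _ _

theorem den_mu {n : ℕ} {A : Ty (n + 1)} (hA : (mu A).WF) (r : Fin n → Obj) :
    A.den (Fin.cons ((mu A).den r) r) = (mu A).den r :=
  Obj.fix_eq (F := fun X => A.den (Fin.cons X r)) <|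
    Obj.exists_fixed fun m X Y hXY => den_agree A hA.2 m _ _
      (fun k => by
        cases k using Fin.cases with
        | zero => exact hXY
        | succ k => exact Obj.Agree.refl _ _)
      (fun k hk => by
        cases k using Fin.cases with
        | zero => exact absurd hA.1 hk
        | succ k => exact Obj.Agree.refl _ _)

theorem den_rename {n : ℕ} (A : Ty n) : ∀ {m : ℕ} (f : Fin n → Fin m) (r : Fin m → Obj),
    (rename f A).den r = A.den fun k => r (f k) := by
  induction A with
  | mu A ih =>
    intro m f r
    simp only [rename, den]
    congr 1
    funext X
    rw [ih]
    congr 1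
    funext k
    cases k using Fin.cases <;> rfl
  | _ => intros; simp_all [rename, den]

theorem den_subst {n : ℕ} (A : Ty n) : ∀ {m : ℕ} (s : Fin n → Ty m) (r : Fin m → Obj),
    (subst s A).den r = A.den fun k => (s k).den r := by
  induction A with
  | mu A ih =>
    intro m s r
    simp only [subst, den]
    congr 1
    funext X
    rw [ih]
    congr 1
    funext k
    cases k using Fin.cases with
    | zero => rfl
    | succ k => simp [den_rename]
  | _ => intros; simp_all [subst, den]

/-- A recursive type and its unfolding have the same denotation. -/
theorem obj_mu {A : Ty 1} (hA : (mu A).WF) : (mu A).obj = (A.inst (mu A)).obj := by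
  rw [obj, ← den_mu hA, obj, inst, den_subst]
  congr 1
  funext k
  cases k using Fin.cases with
  | zero => rfl
  | succ k => exact k.elim0

end Ty

/-! ### Constant types denote constant objects -/

namespace Obj

/-- Constant objects: all restriction functions are bijections. -/
def IsConst (X : Obj) : Prop := ∀ i, Function.Bijective (X.res i)

theorem isConst_const (Z : Type) : (const Z).IsConst := fun _ => Function.bijective_id

theorem IsConst.prod {X Y : Obj} (hX : X.IsConst) (hY : Y.IsConst) : (prod X Y).IsConst :=
  fun i => (hX i).prodMap (hY i)

theorem IsConst.sum {X Y : Obj} (hX : X.IsConst) (hY : Y.IsConst) : (sum X Y).IsConst :=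
  fun i => ⟨(hX i).1.sumMap (hY i).1, (hX i).2.sumMap (hY i).2⟩

theorem IsConst.exp (X : Obj) {Y : Obj} (hY : Y.IsConst) : (exp X Y).IsConst := by
  intro i
  constructor
  · intro f g hfg
    have h1 : ∀ j : Fin (i + 1), f.1 j.castSucc = g.1 j.castSucc := fun j =>
      congrFun (congrArg Subtype.val hfg) j
    apply Subtype.ext
    funext j
    cases j using Fin.lastCases with
    | cast j => exact h1 j
    | last =>
      funext x
      have hf := f.2 (Fin.last i) x
      have hg := g.2 (Fin.last i) x
      rw [h1, hg] at hf
      exact ((hY i).1 hf).symm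
  · intro f
    choose inv hinv using fun y => (hY i).2 y
    let g : ∀ j : Fin (i + 2), X.el j → Y.el j :=
      Fin.lastCases (motive := fun j : Fin (i + 2) => X.el j → Y.el j)
        (fun x => inv (f.1 (Fin.last i) (X.res i x))) (fun j => f.1 j)
    have hg : ∀ j : Fin (i + 1), g j.castSucc = f.1 j := fun j => Fin.lastCases_castSucc j
    have hl : g (Fin.last (i + 1)) = fun x => inv (f.1 (Fin.last i) (X.res i x)) :=
      Fin.lastCases_last
    refine ⟨⟨g, ?_⟩, Subtype.ext (funext hg)⟩
    intro j
    cases j using Fin.lastCases with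
    | cast j =>
      intro x
      change g j.castSucc.castSucc (X.res j x) = Y.res j (g j.succ.castSucc x)
      rw [hg, hg]
      exact f.2 j x
    | last =>
      intro x
      change g (Fin.last i).castSucc (X.res i x) = Y.res i (g (Fin.last (i + 1)) x)
      rw [hg, hl]
      exact (hinv _).symm

theorem IsConst.pi {n : ℕ} {X : Fin n → Obj} (h : ∀ k, (X k).IsConst) : (pi X).IsConst := by
  intro i
  constructor
  · intro x y hxy
    funext k
    exact (h k i).1 (congrFun hxy k)
  · intro y
    choose x hx using fun k => (h k i).2 (y k)
    exact ⟨x, funext hx⟩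

/-- An element of a constant object at any stage determines elements at all stages, by restriction
and by the inverses of restriction; this is the resulting global element. -/
noncomputable def IsConst.glob {X : Obj} (h : X.IsConst) {i : ℕ} (x : X.el i) : X.Global :=
  ⟨fun j => Nat.rec (X.restr (Nat.zero_le i) x) (fun k y => ((h k).2 y).choose) j,
    fun j => ((h j).2 _).choose_spec⟩

theorem IsConst.glob_restr {X : Obj} (h : X.IsConst) {i : ℕ} (x : X.el i) {j : ℕ} (hj : j ≤ i) :
    (h.glob x).1 j = X.restr hj x := by
  induction j with
  | zero => rfl
  | succ j ih => exact (h j).1 (((h.glob x).2 j).trans ((ih (by lia)).trans (X.restr_succ hj x)))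

theorem IsConst.glob_self {X : Obj} (h : X.IsConst) {i : ℕ} (x : X.el i) :
    (h.glob x).1 i = x := (h.glob_restr x le_rfl).trans (X.restr_self x)

theorem IsConst.glob_res {X : Obj} (h : X.IsConst) {i : ℕ} (x : X.el (i + 1)) :
    h.glob (X.res i x) = h.glob x := by
  apply Subtype.ext
  funext j
  induction j with
  | zero => exact (X.restr_res (Nat.zero_le i) x).symm
  | succ j ih => exact (h j).1 (((h.glob _).2 j).trans (ih.trans ((h.glob x).2 j).symm))

end Obj

theorem Ty.isConst_den {n : ℕ} (A : Ty n) (hA : A.WF) (hc : A.Constant) (r : Fin n → Obj)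
    (h : ∀ k, ¬ GuardedIn k A → (r k).IsConst) : (A.den r).IsConst := by
  induction A with
  | var k => exact h k (by simp [GuardedIn])
  | nat => exact Obj.isConst_const _
  | one => exact Obj.isConst_const _
  | prod A B ihA ihB =>
    exact (ihA hA.1 hc.1 r fun k hk => h k fun hg => hk hg.1).prod
      (ihB hA.2 hc.2 r fun k hk => h k fun hg => hk hg.2)
  | empty => exact Obj.isConst_const _
  | sum A B ihA ihB =>
    exact (ihA hA.1 hc.1 r fun k hk => h k fun hg => hk hg.1).sum
      (ihB hA.2 hc.2 r fun k hk => h k fun hg => hk hg.2)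
  | arr A B ihA ihB =>
    exact Obj.IsConst.exp _ (ihB hA.2 hc.2 r fun k hk => h k fun hg => hk hg.2)
  | mu A ih =>
    rw [← den_mu hA]
    refine ih hA.2 hc _ fun k hk => ?_
    cases k using Fin.cases with
    | zero => exact absurd hA.1 hk
    | succ k => exact h k hk
  | later A ih => exact hc.elim
  | box A ih => exact Obj.isConst_const _

theorem Ctx.isConst_obj {n : ℕ} {Γ : Ctx n} (h : ∀ k, (Γ k).WF) (hc : ∀ k, (Γ k).Constant) :
    Γ.obj.IsConst :=
  Obj.IsConst.pi fun k => (Γ k).isConst_den (h k) (hc k) _ fun j => j.elim0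

/-! ### Denotations of terms -/

namespace Hom

open Obj

/-- Composition, in diagrammatic order. -/
def comp {X Y Z : Obj} (f : Hom X Y) (g : Hom Y Z) : Hom X Z :=
  ⟨fun i x => g.app i (f.app i x), fun i x => by rw [f.nat, g.nat]⟩

/-- The identity arrow between equal objects. -/
def ofEq {X Y : Obj} (h : X = Y) : Hom X Y := h ▸ ⟨fun _ x => x, fun _ _ => rfl⟩

theorem nat_restr {X Y : Obj} (f : Hom X Y) {i j : ℕ} (h : j ≤ i) (x : X.el i) :
    f.app j (X.restr h x) = Y.restr h (f.app i x) := by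
  induction h using Nat.decreasingInduction with
  | self => rw [restr_self, restr_self]
  | of_succ k h ih => rw [restr_succ X h, restr_succ Y h, f.nat, ih]

/-- The arrow with constant value `z`. -/
def const (X : Obj) {Z : Type} (z : Z) : Hom X (.const Z) := ⟨fun _ _ => z, fun _ _ => rfl⟩

/-- Successor on the natural numbers object. -/
def succ : Hom (.const ℕ) (.const ℕ) := ⟨fun _ => Nat.succ, fun _ _ => rfl⟩

def pair {X Y Z : Obj} (f : Hom X Y) (g : Hom X Z) : Hom X (.prod Y Z) :=
  ⟨fun i x => (f.app i x, g.app i x), fun i x => Prod.ext (f.nat i x) (g.nat i x)⟩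

def fst (X Y : Obj) : Hom (.prod X Y) X := ⟨fun _ p => p.1, fun _ _ => rfl⟩

def snd (X Y : Obj) : Hom (.prod X Y) Y := ⟨fun _ p => p.2, fun _ _ => rfl⟩

/-- The arrow out of the initial object. -/
def abort (X : Obj) : Hom (.const Empty) X := ⟨fun _ x => x.elim, fun _ x => x.elim⟩

def inl (X Y : Obj) : Hom X (.sum X Y) := ⟨fun _ => Sum.inl, fun _ _ => rfl⟩

def inr (X Y : Obj) : Hom Y (.sum X Y) := ⟨fun _ => Sum.inr, fun _ _ => rfl⟩

/-- Case distinction with parameters from `G`. -/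
def cases {G X Y Z : Obj} (t : Hom G (.sum X Y)) (f : Hom (.prod G X) Z)
    (g : Hom (.prod G Y) Z) : Hom G Z where
  app i γ := Sum.elim (fun x => f.app i (γ, x)) (fun y => g.app i (γ, y)) (t.app i γ)
  nat i γ := by
    rw [t.nat]
    cases t.app (i + 1) γ with
    | inl x => exact f.nat i (γ, x)
    | inr y => exact g.nat i (γ, y)

/-- The transpose of `f`: it sends `γ` at stage `i` to the tuple whose entry `j ≤ i` is
`a ↦ f_j (γ restricted to j, a)`. -/
def curry {G X Y : Obj} (f : Hom (.prod G X) Y) : Hom G (.exp X Y) where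
  app i γ := ⟨fun j x => f.app j (G.restr (Nat.lt_succ_iff.mp j.2) γ, x), fun j x =>
    (congrArg (fun y => f.app j (y, X.res j x)) (G.restr_succ j.2 γ)).trans
      (f.nat j (G.restr j.2 γ, x))⟩
  nat i γ := by
    apply Subtype.ext
    funext j x
    exact congrArg (fun y => f.app j (y, x)) (G.restr_res (Nat.lt_succ_iff.mp j.2) γ).symm

/-- Evaluation: at stage `i` the last entry of a tuple is applied. -/
def eval (X Y : Obj) : Hom (.prod (.exp X Y) X) Y where
  app i p := p.1.1 (Fin.last i) p.2
  nat i p := p.1.2 (Fin.last i) p.2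

/-- The natural transformation `next : X → ▶X`. -/
def next (X : Obj) : Hom X (.later X) where
  app := fun | 0 => fun _ => () | i + 1 => X.res i
  nat := fun | 0 => fun _ => rfl | _ + 1 => fun _ => rfl

/-- The action of the functor `▶` on arrows. -/
def later {X Y : Obj} (f : Hom X Y) : Hom (.later X) (.later Y) where
  app := fun | 0 => fun _ => () | i + 1 => f.app i
  nat := fun | 0 => fun _ => rfl | i + 1 => f.nat i

/-- The arrow `▶X × ▶Y → ▶(X × Y)`. -/
def laterPair (X Y : Obj) : Hom (.prod (.later X) (.later Y)) (.later (.prod X Y)) where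
  app := fun | 0 => fun _ => () | _ + 1 => fun p => p
  nat := fun | 0 => fun _ => rfl | _ + 1 => fun _ => rfl

/-- The counit `unbox : ■X → X`. -/
def unbox (X : Obj) : Hom (.box X) X := ⟨fun i a => a.1 i, fun i a => (a.2 i).symm⟩

/-- The action of an arrow on global elements. -/
def onGlobal {X Y : Obj} (f : Hom X Y) (a : X.Global) : Y.Global :=
  ⟨fun i => f.app i (a.1 i), fun i => by rw [← f.nat, a.2]⟩

/-- The denotation of `prev`, for constant `D`. -/
noncomputable def prev {G D X : Obj} (hD : D.IsConst) (s : Hom G D) (t : Hom D (.later X)) :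
    Hom G X where
  app i γ := (t.onGlobal (hD.glob (s.app i γ))).1 (i + 1)
  nat i γ := by
    rw [s.nat, hD.glob_res]
    exact ((t.onGlobal (hD.glob (s.app (i + 1) γ))).2 (i + 1)).symm

/-- The denotation of `box`, for constant `D`. -/
noncomputable def box {G D X : Obj} (hD : D.IsConst) (s : Hom G D) (t : Hom D X) :
    Hom G (.box X) where
  app i γ := t.onGlobal (hD.glob (s.app i γ))
  nat i γ := by
    rw [s.nat, hD.glob_res]

end Hom

namespace Obj

theorem isLeft_global {X Y : Obj} (a : (sum X Y).Global) (i : ℕ) :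
    (a.1 i).isLeft = (a.1 0).isLeft := by
  induction i with
  | zero => rfl
  | succ i ih =>
    rw [← ih, ← a.2 i]
    change _ = (Sum.map (X.res i) (Y.res i) (a.1 (i + 1))).isLeft
    cases a.1 (i + 1) <;> rfl

/-- All the components of a global element of `X + Y` lie on the same side of the sum; it is thus a
global element of `X` or one of `Y`. -/
def splitGlobal {X Y : Obj} (a : (sum X Y).Global) : X.Global ⊕ Y.Global :=
  if h : (a.1 0).isLeft then
    .inl ⟨fun i => (a.1 i).getLeft ((isLeft_global a i).trans h), fun i => by
      apply Sum.inl_injective (β := Y.el i)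
      refine Eq.trans ?_ (Sum.inl_getLeft (a.1 i) ((isLeft_global a i).trans h)).symm
      refine Eq.trans ?_ (a.2 i)
      exact congrArg (Sum.map (X.res i) (Y.res i)) (Sum.inl_getLeft (a.1 (i + 1)) ((isLeft_global a (i + 1)).trans h))⟩
  else
    have h' : ∀ i, (a.1 i).isRight := fun i =>
      Sum.not_isLeft.mp fun hl => h ((isLeft_global a i).symm.trans hl)
    .inr ⟨fun i => (a.1 i).getRight (h' i), fun i => by
      apply Sum.inr_injective (α := X.el i)
      refine Eq.trans ?_ (Sum.inr_getRight (a.1 i) (h' i)).symm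
      refine Eq.trans ?_ (a.2 i)
      exact congrArg (Sum.map (X.res i) (Y.res i)) (Sum.inr_getRight (a.1 (i + 1)) (h' (i + 1)))⟩

end Obj

/-- The arrow `■(X + Y) → ■X + ■Y`. -/
def Hom.split (X Y : Obj) : Hom (.box (.sum X Y)) (.sum (.box X) (.box Y)) where
  app _ a := Obj.splitGlobal a
  nat i a := by
    change Obj.splitGlobal a = Sum.map id id (Obj.splitGlobal a)
    rw [Sum.map_id_id, id]

namespace Ctx

/-- Extension of an environment by a value for the new variable. -/
noncomputable def cons {n : ℕ} (Γ : Ctx n) (A : Ty 0) :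
    Hom (.prod Γ.obj A.obj) (Ctx.ext A Γ).obj where
  app i p := fun k =>
    Fin.cases (motive := fun k => ((Ctx.ext A Γ k).obj).el i) p.2 (fun k => p.1 k) k
  nat i p := by
    funext k
    cases k using Fin.cases <;> rfl

/-- The projection to a variable. -/
noncomputable def proj {n : ℕ} (Γ : Ctx n) (k : Fin n) : Hom Γ.obj (Γ k).obj :=
  ⟨fun _ γ => γ k, fun _ _ => rfl⟩

/-- The arrow into a context that is given by its components. -/
noncomputable def tuple {m : ℕ} {X : Obj} (Δ : Ctx m) (f : ∀ k, Hom X (Δ k).obj) :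
    Hom X Δ.obj :=
  ⟨fun i x k => (f k).app i x, fun i x => funext fun k => (f k).nat i x⟩

end Ctx

/-- The denotation of a typing derivation of `Γ ⊢ t : A`. -/
noncomputable def HasType.den : {n : ℕ} → {Γ : Ctx n} → {t : Tm n} → {A : Ty 0} →
    HasType Γ t A → Hom Γ.obj A.obj
  | _, Γ, _, _, var k => Γ.proj k
  | _, Γ, _, _, zero => Hom.const Γ.obj (0 : ℕ)
  | _, _, _, _, succ d => d.den.comp Hom.succ
  | _, Γ, _, _, unit => Hom.const Γ.obj ()
  | _, _, _, _, pair d e => Hom.pair d.den e.den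
  | _, _, _, _, fst d => d.den.comp (Hom.fst _ _)
  | _, _, _, _, snd d => d.den.comp (Hom.snd _ _)
  | _, _, _, _, abort _ d => d.den.comp (Hom.abort _)
  | _, _, _, _, inl _ d => d.den.comp (Hom.inl _ _)
  | _, _, _, _, inr _ d => d.den.comp (Hom.inr _ _)
  | _, Γ, _, _, caseOf d e₁ e₂ =>
      Hom.cases d.den ((Γ.cons _).comp e₁.den) ((Γ.cons _).comp e₂.den)
  | _, Γ, _, _, lam _ d => Hom.curry ((Γ.cons _).comp d.den)
  | _, _, _, _, app d e => (Hom.pair d.den e.den).comp (Hom.eval _ _)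
  | _, _, _, _, fold h d => d.den.comp (Hom.ofEq (Ty.obj_mu h).symm)
  | _, _, _, _, unfold h d => d.den.comp (Hom.ofEq (Ty.obj_mu h))
  | _, _, _, _, next d => d.den.comp (Hom.next _)
  | _, _, _, _, prev (Δ := Δ) h hc d e =>
      Hom.prev (Ctx.isConst_obj h hc) (Δ.tuple fun k => (e k).den) d.den
  | _, _, _, _, ap d e =>
      (Hom.pair d.den e.den).comp ((Hom.laterPair _ _).comp (Hom.later (Hom.eval _ _)))
  | _, _, _, _, box (Δ := Δ) h hc d e =>
      Hom.box (Ctx.isConst_obj h hc) (Δ.tuple fun k => (e k).den) d.den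
  | _, _, _, _, unbox d => d.den.comp (Hom.unbox _)
  | _, _, _, _, boxSum (Δ := Δ) h hc d e =>
      (Hom.box (Ctx.isConst_obj h hc) (Δ.tuple fun k => (e k).den) d.den).comp (Hom.split _ _)

/-! ### The program logic -/

/-- Subobjects. -/
@[ext]
structure Sub (X : Obj) : Type where
  mem : ∀ i, X.el i → Prop
  res : ∀ i x, mem (i + 1) x → mem i (X.res i x)

namespace Sub

theorem restr {X : Obj} (P : Sub X) {i j : ℕ} (h : j ≤ i) {x : X.el i} (hx : P.mem i x) :
    P.mem j (X.restr h x) := by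
  induction h using Nat.decreasingInduction with
  | self => rwa [Obj.restr_self]
  | of_succ k h ih =>
    rw [Obj.restr_succ X h]
    exact P.res k _ ih

/-- Inclusion of subobjects. -/
def Le {X : Obj} (P Q : Sub X) : Prop := ∀ i x, P.mem i x → Q.mem i x

def top (X : Obj) : Sub X := ⟨fun _ _ => True, fun _ _ _ => trivial⟩

def bot (X : Obj) : Sub X := ⟨fun _ _ => False, fun _ _ h => h⟩

def and {X : Obj} (P Q : Sub X) : Sub X :=
  ⟨fun i x => P.mem i x ∧ Q.mem i x, fun i x h => ⟨P.res i x h.1, Q.res i x h.2⟩⟩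

def or {X : Obj} (P Q : Sub X) : Sub X :=
  ⟨fun i x => P.mem i x ∨ Q.mem i x, fun i x h => h.imp (P.res i x) (Q.res i x)⟩

/-- Heyting implication. -/
def imp {X : Obj} (P Q : Sub X) : Sub X where
  mem i x := ∀ j (h : j ≤ i), P.mem j (X.restr h x) → Q.mem j (X.restr h x)
  res i x H j h := by
    rw [← X.restr_res h x]
    exact H j (Nat.le_succ_of_le h)

def not {X : Obj} (P : Sub X) : Sub X := P.imp (bot X)

/-- The equaliser of two arrows. -/
def eq {X Y : Obj} (f g : Hom X Y) : Sub X :=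
  ⟨fun i x => f.app i x = g.app i x, fun i x h => by rw [f.nat, g.nat, h]⟩

/-- Inverse image along an arrow. -/
def pullback {X Y : Obj} (f : Hom X Y) (P : Sub Y) : Sub X :=
  ⟨fun i x => P.mem i (f.app i x), fun i x h => by rw [f.nat]; exact P.res i _ h⟩

/-- Universal quantification along the projection `X × Y → X`. -/
def all {X Y : Obj} (P : Sub (.prod X Y)) : Sub X where
  mem i x := ∀ j (h : j ≤ i) (y : Y.el j), P.mem j (X.restr h x, y)
  res i x H j h y := by
    rw [← X.restr_res h x]
    exact H j (Nat.le_succ_of_le h) y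

/-- Existential quantification along the projection `X × Y → X`. -/
def ex {X Y : Obj} (P : Sub (.prod X Y)) : Sub X where
  mem i x := ∃ y : Y.el i, P.mem i (x, y)
  res i x := fun ⟨y, h⟩ => ⟨Y.res i y, P.res i (x, y) h⟩

/-- The modality 'later'. -/
def later {X : Obj} (P : Sub X) : Sub X where
  mem := fun | 0 => fun _ => True | i + 1 => fun x => P.mem i (X.res i x)
  res := fun | 0 => fun _ _ => trivial | i + 1 => fun _ h => P.res i _ h

/-- The modality 'always': the right adjoint of double negation, so `always P` is the largest
subobject `Q` with `¬¬Q ≤ P`. -/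
def always {X : Obj} (P : Sub X) : Sub X where
  mem i x := ∃ Q : Sub X, Q.not.not.Le P ∧ Q.mem i x
  res i x := fun ⟨Q, hQ, h⟩ => ⟨Q, hQ, Q.res i x h⟩

end Sub

/-- An element of the guarded conatural numbers, at stage `i`, is regarded as true at stage `i`
when it is a successor and, for `i > 0`, its predecessor is true at stage `i - 1`. -/
def IsTrue : (i : ℕ) → Ty.gCoNat.obj.el i → Prop
  | 0, x => ∃ y : Unit, (Hom.ofEq (Ty.obj_mu Ty.gCoNat_wf)).app 0 x = Sum.inr y
  | i + 1, x => ∃ y : Ty.gCoNat.obj.el i,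
      (Hom.ofEq (Ty.obj_mu Ty.gCoNat_wf)).app (i + 1) x = Sum.inr y ∧ IsTrue i y

theorem IsTrue.res : ∀ (i : ℕ) (x : Ty.gCoNat.obj.el (i + 1)), IsTrue (i + 1) x →
    IsTrue i (Ty.gCoNat.obj.res i x) := by
  intro i
  induction i with
  | zero =>
    rintro x ⟨y, hy, -⟩
    exact ⟨(), ((Hom.ofEq (Ty.obj_mu Ty.gCoNat_wf)).nat 0 x).trans
      (congrArg (Obj.res (Ty.inst _ Ty.gCoNat).obj 0) hy)⟩
  | succ i ih =>
    rintro x ⟨y, hy, h⟩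
    exact ⟨Ty.gCoNat.obj.res i y, ((Hom.ofEq (Ty.obj_mu Ty.gCoNat_wf)).nat (i + 1) x).trans
      (congrArg (Obj.res (Ty.inst _ Ty.gCoNat).obj (i + 1)) hy), ih y h⟩

/-- The generic subobject of the guarded conatural numbers, which makes them a subobject
classifier. -/
def Sub.generic : Sub Ty.gCoNat.obj := ⟨IsTrue, IsTrue.res⟩

/-- Propositions of the logic in context `Γ`. The types of the logic are the closed types of the
calculus and its terms are the terms of the calculus. As `gCoNat` is the type of propositions, a
term of type `gCoNat` is a proposition (`holds`), and quantification over the types `gCoNat` and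
`arr A gCoNat` is quantification over propositions and over predicates. A predicate `P` given by
comprehension is described by `∀ x, P x ⇔ φ`, which determines it. -/
inductive Formula : {n : ℕ} → Ctx n → Type
  | eq {n : ℕ} {Γ : Ctx n} (A : Ty 0) {t u : Tm n} (d : HasType Γ t A) (e : HasType Γ u A) :
      Formula Γ
  | holds {n : ℕ} {Γ : Ctx n} {t : Tm n} (d : HasType Γ t Ty.gCoNat) : Formula Γ
  | top {n : ℕ} {Γ : Ctx n} : Formula Γ
  | bot {n : ℕ} {Γ : Ctx n} : Formula Γ
  | and {n : ℕ} {Γ : Ctx n} (φ ψ : Formula Γ) : Formula Γ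
  | or {n : ℕ} {Γ : Ctx n} (φ ψ : Formula Γ) : Formula Γ
  | imp {n : ℕ} {Γ : Ctx n} (φ ψ : Formula Γ) : Formula Γ
  | all {n : ℕ} {Γ : Ctx n} (A : Ty 0) (hA : A.WF) (φ : Formula (Ctx.ext A Γ)) : Formula Γ
  | ex {n : ℕ} {Γ : Ctx n} (A : Ty 0) (hA : A.WF) (φ : Formula (Ctx.ext A Γ)) : Formula Γ
  | later {n : ℕ} {Γ : Ctx n} (φ : Formula Γ) : Formula Γ
  | always {n : ℕ} {Γ : Ctx n} (φ : Formula Γ) : Formula Γ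

/-- The interpretation of a proposition in context `Γ` as a subobject of the denotation of `Γ`. -/
noncomputable def Formula.sub : {n : ℕ} → {Γ : Ctx n} → Formula Γ → Sub Γ.obj
  | _, _, eq _ d e => Sub.eq d.den e.den
  | _, _, holds d => Sub.pullback d.den Sub.generic
  | _, _, top => Sub.top _
  | _, _, bot => Sub.bot _
  | _, _, and φ ψ => Sub.and φ.sub ψ.sub
  | _, _, or φ ψ => Sub.or φ.sub ψ.sub
  | _, _, imp φ ψ => Sub.imp φ.sub ψ.sub
  | _, Γ, all A _ φ => Sub.all (Sub.pullback (Γ.cons A) φ.sub)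
  | _, Γ, ex A _ φ => Sub.ex (Sub.pullback (Γ.cons A) φ.sub)
  | _, _, later φ => Sub.later φ.sub
  | _, _, always φ => Sub.always φ.sub

/-- Provability of the sequent `Γ ∣ Ξ ⊢ φ`. The logic is by definition the internal logic of the
topos of trees, so this says that the sequent holds there: the intersection of the subobjects of
`Γ` which interpret the propositions in `Ξ` is included in the one which interprets `φ`. (A sequent
that is derivable in any deductive system sound for the internal logic is provable in this
sense.) -/
def Provable {n : ℕ} (Γ : Ctx n) (Ξ : Set (Formula Γ)) (φ : Formula Γ) : Prop :=
  ∀ i (γ : Γ.obj.el i), (∀ ψ ∈ Ξ, ψ.sub.mem i γ) → φ.sub.mem i γ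

end GuardedLambda

namespace GuardedLambda

/-! ### Substitution -/

namespace Tm

/-! Contextual equivalence follows from two facts about the denotation: it is compositional and it
is adequate. A provable equation without assumptions makes the two arrows equal. By compositionality
(`CxType.exists_den_eq`) the two fillings of a closing context of type `nat` then have derivations
with the same denotation, and by adequacy (`HasType.reduces_numeral`) each filling reduces to the
numeral that this denotation names.

Adequacy is the substantial half. It rests on a logical relation `Rel A i x t` between elements `x`
of the denotation of `A` at stage `i` and closed terms `t`. Terms are observed by elimination at
products, functions, recursive types and `box`, and by reduction to an introduction form at numbers,
sums and, at positive stages, `later`. At `box` the relation is required at all stages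
simultaneously, so neither induction on the stage nor induction on the type alone can define it. The
lexicographic measure of box depth, stage and unguarded size does: passing beneath a `box` lowers
the first component, beneath a `later` the second, and every other former the third. A guarded
recursive type lowers the third as well, because the copies made by unfolding lie beneath `later`.

The fundamental lemma `HasType.rel` says that every typed term is related to its denotation under
related substitutions. It needs closure of the relation under expansion (`Rel.expand`) and under
restriction (`Rel.res`). It also needs independence of the stage at constant types (`Rel.of_res`),
which permits the evaluation of the bodies of `prev`, `box` and `boxSum` at stages other than the
current one. Finally, determinism of reduction makes the introduction forms found at different
stages of a `boxSum` coincide (`Rel.splitGlobal`). -/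

theorem rename_rename {n : ℕ} (t : Tm n) : ∀ {m l : ℕ} (f : Fin n → Fin m) (g : Fin m → Fin l),
    rename g (rename f t) = rename (fun k => g (f k)) t := by
  have key : ∀ {n m l : ℕ} (f : Fin n → Fin m) (g : Fin m → Fin l),
      (fun k => (Fin.cons 0 fun k => (g k).succ : Fin (m + 1) → Fin (l + 1))
        ((Fin.cons 0 fun k => (f k).succ : Fin (n + 1) → Fin (m + 1)) k)) =
      (Fin.cons 0 fun k => (g (f k)).succ : Fin (n + 1) → Fin (l + 1)) := by
    intro n m l f g
    funext k
    cases k using Fin.cases <;> rfl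
  induction t with
  | lam t ih => intros; simp only [rename, ih, key]
  | caseOf t u₁ u₂ ih ih₁ ih₂ => intros; simp only [rename, ih, ih₁, ih₂, key]
  | _ => intros; simp only [rename, *]

theorem subst_rename {n : ℕ} (t : Tm n) : ∀ {m l : ℕ} (f : Fin n → Fin m) (s : Fin m → Tm l),
    subst s (rename f t) = subst (fun k => s (f k)) t := by
  have key : ∀ {n m l : ℕ} (f : Fin n → Fin m) (s : Fin m → Tm l),
      (fun k => lift s ((Fin.cons 0 fun k => (f k).succ : Fin (n + 1) → Fin (m + 1)) k)) =
      lift fun k => s (f k) := by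
    intro n m l f s
    funext k
    cases k using Fin.cases <;> rfl
  induction t with
  | lam t ih => intros; simp only [rename, subst, ih, key]
  | caseOf t u₁ u₂ ih ih₁ ih₂ => intros; simp only [rename, subst, ih, ih₁, ih₂, key]
  | _ => intros; simp only [rename, subst, *]

theorem rename_subst {n : ℕ} (t : Tm n) : ∀ {m l : ℕ} (s : Fin n → Tm m) (f : Fin m → Fin l),
    rename f (subst s t) = subst (fun k => rename f (s k)) t := by
  have key : ∀ {n m l : ℕ} (s : Fin n → Tm m) (f : Fin m → Fin l),
      (fun k => rename (Fin.cons 0 fun k => (f k).succ) (lift s k)) =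
      lift fun k => rename f (s k) := by
    intro n m l s f
    funext k
    cases k using Fin.cases with
    | zero => rfl
    | succ k =>
      simp only [lift, Fin.cons_succ]
      rw [rename_rename, rename_rename]
      simp only [Fin.cons_succ]
  induction t with
  | lam t ih => intros; simp only [rename, subst, ih, key]
  | caseOf t u₁ u₂ ih ih₁ ih₂ => intros; simp only [rename, subst, ih, ih₁, ih₂, key]
  | _ => intros; simp only [rename, subst, *]

/-- Beneath a binder the entries of `s` are weakened, so moving `r` past the weakening takes both
mixed laws of renaming and substitution. Bodies of `prev`, `box` and `boxSum` are untouched, as only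
the explicit substitution in front of them is affected. -/
theorem subst_subst {n : ℕ} (t : Tm n) : ∀ {m l : ℕ} (s : Fin n → Tm m) (r : Fin m → Tm l),
    subst r (subst s t) = subst (fun k => subst r (s k)) t := by
  have key : ∀ {n m l : ℕ} (s : Fin n → Tm m) (r : Fin m → Tm l),
      (fun k => subst (lift r) (lift s k)) = lift fun k => subst r (s k) := by
    intro n m l s r
    funext k
    cases k using Fin.cases with
    | zero => rfl
    | succ k =>
      simp only [lift, Fin.cons_succ]
      rw [subst_rename, rename_subst]
      simp only [Fin.cons_succ]
  induction t with
  | lam t ih => intros; simp only [subst, ih, key]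
  | caseOf t u₁ u₂ ih ih₁ ih₂ => intros; simp only [subst, ih, ih₁, ih₂, key]
  | _ => intros; simp only [subst, *]

theorem subst_var {n : ℕ} (t : Tm n) : subst var t = t := by
  have key : ∀ n : ℕ, lift (var : Fin n → Tm n) = var := by
    intro n
    funext k
    cases k using Fin.cases <;> rfl
  induction t with
  | lam t ih => simp only [subst, key, ih]
  | caseOf t u₁ u₂ ih ih₁ ih₂ => simp only [subst, key, ih, ih₁, ih₂]
  | _ => simp only [subst, *]

theorem subst_closed (s : Fin 0 → Tm 0) (t : Tm 0) : subst s t = t := by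
  rw [Subsingleton.elim s var, subst_var]

/-- This turns the contractum of a beta or case step on a closed instance into a single substitution
by an extended environment, the form in which the induction hypotheses of `HasType.rel` apply. -/
theorem inst_subst_lift {n m : ℕ} (t : Tm (n + 1)) (s : Fin n → Tm m) (u : Tm m) :
    (subst (lift s) t).inst u = subst (Fin.cons u s) t := by
  rw [inst, subst_subst]
  congr 1
  funext k
  cases k using Fin.cases with
  | zero => rfl
  | succ k =>
    simp only [lift, Fin.cons_succ]
    rw [subst_rename]
    exact subst_var _

/-- The numeral `succⁿ zero`. -/
def numeral : ℕ → Tm 0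
  | 0 => zero
  | n + 1 => succ (numeral n)

theorem value_numeral (n : ℕ) : Value (numeral n) := by
  refine .numeral ?_
  induction n with
  | zero => exact .zero
  | succ n ih => exact .succ ih

end Tm

/-! ### Reduction -/

theorem Reduces.congr {f : Tm 0 → Tm 0} (hf : ∀ {t u : Tm 0}, Step t u → Step (f t) (f u))
    {t u : Tm 0} (h : Reduces t u) : Reduces (f t) (f u) :=
  by
  induction h with
  | refl => exact .refl
  | tail _ hs ih => exact ih.tail (hf hs)

theorem Rule.reduces {t u : Tm 0} (h : Rule t u) : Reduces t u := .single (.rule h)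

theorem Numeral.not_step {t u : Tm 0} (ht : Numeral t) : ¬ Step t u := by
  induction ht generalizing u with
  | zero =>
    intro h
    cases h with
    | rule h => cases h
  | succ _ ih =>
    intro h
    cases h with
    | rule h => cases h
    | succ h => exact ih h

theorem Value.not_step {t u : Tm 0} (ht : Value t) : ¬ Step t u := by
  intro h
  cases ht with
  | numeral ht => exact ht.not_step h
  | _ =>
    cases h with
    | rule h => cases h

theorem Rule.deterministic {t u v : Tm 0} (h : Rule t u) (h' : Rule t v) : u = v := by
  cases h <;> cases h' <;> first | rfl | contradiction

/-- In a redex, the immediate subterm in evaluation position is already a value, so no step can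
occur inside it. -/
theorem Rule.eq_of_step {t u v : Tm 0} (h : Rule t u) (h' : Step t v) : v = u := by
  cases h' with
  | rule h' => exact h'.deterministic h
  | apRight hv h' =>
    cases h
    exact absurd h' (Value.next _).not_step
  | prev s h' =>
    cases h with
    -- Evaluation beneath `prev` takes place for the empty explicit substitution only, and
    -- `prevSubst` for a non-empty one only.
    | prevSubst _ _ h => exact absurd rfl h
    | prevNext => exact absurd h' (Value.next _).not_step
  | boxSum s h' =>
    cases h with
    | boxSumSubst _ _ h => exact absurd rfl h
    | boxSumInl => exact absurd h' (Value.inl _).not_step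
    | boxSumInr => exact absurd h' (Value.inr _).not_step
  | _ =>
    cases h <;> refine absurd ‹Step _ _› (Value.not_step ?_) <;>
      first | exact .pair _ _ | exact .inl _ | exact .inr _ | exact .lam _ | exact .fold _ |
        exact .next _ | exact .box _ _

/-- Only `ap` has two evaluation positions. They do not compete, since the right one is available
only when the left argument is a value, and values do not step. -/
theorem Step.deterministic {t u v : Tm 0} (h : Step t u) (h' : Step t v) : u = v := by
  induction h generalizing v with
  | rule h => exact (h.eq_of_step h').symm
  | apLeft w h ih =>
    cases h' with
    | rule h' => exact h'.eq_of_step (.apLeft w h)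
    | apLeft _ h' => rw [ih h']
    | apRight hv _ => exact absurd h hv.not_step
  | apRight hv h ih =>
    cases h' with
    | rule h' => exact h'.eq_of_step (.apRight hv h)
    | apLeft _ h' => exact absurd h' hv.not_step
    | apRight _ h' => rw [ih h']
  | prev s h ih =>
    cases h' with
    | rule h' => exact h'.eq_of_step (.prev s h)
    | prev _ h' => rw [ih h']
  | boxSum s h ih =>
    cases h' with
    | rule h' => exact h'.eq_of_step (.boxSum s h)
    | boxSum _ h' => rw [ih h']
  | _ =>
    rename_i h ih
    cases h' with
    | rule h' => exact h'.eq_of_step (by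
      first | exact .succ h | exact .fst h | exact .snd h | exact .caseOf _ _ h | exact .app _ h |
        exact .unfold h | exact .unbox h)
    | _ => rename_i h'; rw [ih h']

theorem Reduces.value_unique {t u v : Tm 0} (hu : Value u) (hv : Value v) (h : Reduces t u)
    (h' : Reduces t v) : u = v := by
  induction h using Relation.ReflTransGen.head_induction_on with
  | refl =>
    rcases Relation.ReflTransGen.cases_head h' with h' | ⟨w, h', -⟩
    · exact h'
    · exact absurd h' hu.not_step
  | head hs _ ih =>
    rcases Relation.ReflTransGen.cases_head h' with rfl | ⟨w, hs', h'⟩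
    · exact absurd hs hv.not_step
    · exact ih (hs.deterministic hs' ▸ h')


/-! ### Measures on types for the recursion that defines the logical relation -/

namespace Ty

/-- The nesting depth of `box` in a type. -/
def boxDepth : {n : ℕ} → Ty n → ℕ
  | _, var _ => 0
  | _, nat => 0
  | _, one => 0
  | _, prod A B => max (boxDepth A) (boxDepth B)
  | _, empty => 0
  | _, sum A B => max (boxDepth A) (boxDepth B)
  | _, arr A B => max (boxDepth A) (boxDepth B)
  | _, mu A => boxDepth A
  | _, later A => boxDepth A
  | _, box A => boxDepth A + 1

/-- The number of type-formers that are neither beneath a `later` nor beneath a `box`. -/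
def unguardedSize : {n : ℕ} → Ty n → ℕ
  | _, var _ => 0
  | _, nat => 0
  | _, one => 0
  | _, prod A B => unguardedSize A + unguardedSize B + 1
  | _, empty => 0
  | _, sum A B => unguardedSize A + unguardedSize B + 1
  | _, arr A B => unguardedSize A + unguardedSize B + 1
  | _, mu A => unguardedSize A + 1
  | _, later _ => 0
  | _, box _ => 0

theorem boxDepth_rename {n : ℕ} (A : Ty n) : ∀ {m : ℕ} (f : Fin n → Fin m),
    (rename f A).boxDepth = A.boxDepth := by
  induction A <;> intros <;> simp only [rename, boxDepth, *]

/-- The type beneath a `box` is closed, so substitution never places anything beneath a `box`;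
depths combine as a maximum and not as a sum. -/
theorem boxDepth_subst_le {n : ℕ} (A : Ty n) : ∀ {m : ℕ} (s : Fin n → Ty m) (c : ℕ),
    A.boxDepth ≤ c → (∀ k, (s k).boxDepth ≤ c) → (subst s A).boxDepth ≤ c := by
  induction A with
  | var k => exact fun s c _ h => h k
  | mu A ih =>
    intro m s c hA h
    refine ih _ c hA fun k => ?_
    cases k using Fin.cases with
    | zero => exact Nat.zero_le c
    | succ k => exact (boxDepth_rename _ _).trans_le (h k)
  | prod A B ihA ihB | sum A B ihA ihB | arr A B ihA ihB =>
    intro m s c hA h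
    exact max_le (ihA s c ((le_max_left _ _).trans hA) h) (ihB s c ((le_max_right _ _).trans hA) h)
  | later A ih => exact fun s c hA h => ih s c hA h
  | _ => exact fun s c hA h => hA

theorem boxDepth_inst_mu (A : Ty 1) : (A.inst (mu A)).boxDepth ≤ (mu A).boxDepth :=
  boxDepth_subst_le A _ _ le_rfl fun k => by
    cases k using Fin.cases with
    | zero => exact le_rfl
    | succ k => exact k.elim0

theorem unguardedSize_rename {n : ℕ} (A : Ty n) : ∀ {m : ℕ} (f : Fin n → Fin m),
    (rename f A).unguardedSize = A.unguardedSize := by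
  induction A <;> intros <;> simp only [rename, unguardedSize, *]

/-- What replaces a guarded variable lands beneath a `later`, where nothing is counted. The
alternative of size zero covers the variable bound by an inner `mu`, which is sent to a variable. -/
theorem unguardedSize_subst {n : ℕ} (A : Ty n) : ∀ {m : ℕ} (s : Fin n → Ty m),
    (∀ k, GuardedIn k A ∨ (s k).unguardedSize = 0) →
    (subst s A).unguardedSize = A.unguardedSize := by
  induction A with
  | var k => exact fun s h => (h k).resolve_left fun hk => hk rfl
  | mu A ih =>
    intro m s h
    refine congrArg (· + 1) (ih _ fun k => ?_)
    cases k using Fin.cases with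
    | zero => exact .inr rfl
    | succ k => exact (h k).imp_right (unguardedSize_rename _ _).trans
  | prod A B ihA ihB | sum A B ihA ihB | arr A B ihA ihB =>
    intro m s h
    simp only [subst, unguardedSize]
    rw [ihA s fun k => (h k).imp_left And.left, ihB s fun k => (h k).imp_left And.right]
  | _ => exact fun s h => rfl

/-- Unfolding removes the outer `mu`, which counts for one, and by guardedness the copies that it
inserts count for nothing. -/
theorem unguardedSize_inst_mu {A : Ty 1} (hA : (mu A).WF) :
    (A.inst (mu A)).unguardedSize < (mu A).unguardedSize := by
  refine Nat.lt_succ_of_le (unguardedSize_subst A _ fun k => ?_).le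
  cases k using Fin.cases with
  | zero => exact .inl hA.1
  | succ k => exact k.elim0

end Ty

/-! ### The logical relation -/

open Classical in
/-- The logical relation between the elements of the denotation of `A` at stage `i` and closed
terms. -/
def Rel : (A : Ty 0) → (i : ℕ) → A.obj.el i → Tm 0 → Prop
  | .nat, _, x, t => Reduces t (Tm.numeral x)
  | .one, _, _, _ => True
  | .prod A B, i, x, t => Rel A i x.1 (.fst t) ∧ Rel B i x.2 (.snd t)
  | .empty, _, _, _ => False
  | .sum A B, i, (x : A.obj.el i ⊕ B.obj.el i), t =>
      (∃ a u, x = .inl a ∧ Reduces t (.inl u) ∧ Rel A i a u) ∨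
        ∃ b u, x = .inr b ∧ Reduces t (.inr u) ∧ Rel B i b u
  -- All stages up to `i` are included, as in the exponential of the topos of trees; this makes the
  -- clause stable under restriction.
  | .arr A B, i, f, t => ∀ (j : Fin (i + 1)) (x : A.obj.el j) (u : Tm 0),
      Rel A j x u → Rel B j (f.1 j x) (.app t u)
  | .mu A, i, x, t =>
      -- Raw types may be unguarded. Well-formedness supplies both the isomorphism with the
      -- unfolding and the decrease of the measure.
      if h : (Ty.mu A).WF then
        Rel (A.inst (.mu A)) i ((Hom.ofEq (Ty.obj_mu h)).app i x) (.unfold t)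
      else False
  -- Stage `0` of a `later` is a singleton and carries no information about the term.
  | .later _, 0, _, _ => True
  | .later A, i + 1, x, t => ∃ u, Reduces t (.next u) ∧ Rel A i x u
  | .box A, _, a, t => ∀ j, Rel A j (a.1 j) (.unbox t)
-- The box depth comes first because the `box` clause refers to arbitrarily large stages; the stage
-- precedes the size because the type beneath a `later` may have any unguarded size.
termination_by A i => (A.boxDepth, i, A.unguardedSize)
decreasing_by
  all_goals first
    | have h₁ := Ty.boxDepth_inst_mu ‹Ty 1›
      have h₂ := Ty.unguardedSize_inst_mu h
      simp only [Prod.lex_def]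
      lia
    | simp only [Prod.lex_def, Ty.boxDepth, Ty.unguardedSize]
      lia

/-! ### The clauses of the logical relation as equivalences -/

section Unfolding

variable {A B : Ty 0} {i : ℕ} {t : Tm 0}

theorem rel_nat {x : Ty.nat.obj.el i} : Rel .nat i x t ↔ Reduces t (Tm.numeral x) := by rw [Rel]

theorem rel_one {x : Ty.one.obj.el i} : Rel .one i x t := by rw [Rel]; trivial

theorem not_rel_empty {x : Empty} : ¬ Rel .empty i x t := x.elim

theorem rel_prod {x : (Ty.prod A B).obj.el i} :
    Rel (.prod A B) i x t ↔ Rel A i x.1 (.fst t) ∧ Rel B i x.2 (.snd t) := by rw [Rel]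

theorem rel_sum {x : (Ty.sum A B).obj.el i} : Rel (.sum A B) i x t ↔
    (∃ a u, (x : A.obj.el i ⊕ B.obj.el i) = .inl a ∧ Reduces t (.inl u) ∧ Rel A i a u) ∨
      ∃ b u, (x : A.obj.el i ⊕ B.obj.el i) = .inr b ∧ Reduces t (.inr u) ∧ Rel B i b u := by
  rw [Rel]
  exact Iff.rfl

theorem rel_inl {a : A.obj.el i} :
    Rel (.sum A B) i (.inl a : A.obj.el i ⊕ B.obj.el i) t ↔
      ∃ u, Reduces t (.inl u) ∧ Rel A i a u := by
  refine rel_sum.trans ⟨?_, fun ⟨u, h⟩ => .inl ⟨a, u, rfl, h⟩⟩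
  rintro (⟨c, u, hc, h⟩ | ⟨c, u, hc, h⟩) <;> cases hc
  exact ⟨u, h⟩

theorem rel_inr {b : B.obj.el i} :
    Rel (.sum A B) i (.inr b : A.obj.el i ⊕ B.obj.el i) t ↔
      ∃ u, Reduces t (.inr u) ∧ Rel B i b u := by
  refine rel_sum.trans ⟨?_, fun ⟨u, h⟩ => .inr ⟨b, u, rfl, h⟩⟩
  rintro (⟨c, u, hc, h⟩ | ⟨c, u, hc, h⟩) <;> cases hc
  exact ⟨u, h⟩

theorem rel_arr {f : (Ty.arr A B).obj.el i} :
    Rel (.arr A B) i f t ↔ ∀ (j : Fin (i + 1)) (x : A.obj.el j) (u : Tm 0),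
      Rel A j x u → Rel B j (f.1 j x) (.app t u) := by rw [Rel]

theorem rel_mu {A : Ty 1} (h : (Ty.mu A).WF) {x : (Ty.mu A).obj.el i} :
    Rel (.mu A) i x t ↔
      Rel (A.inst (.mu A)) i ((Hom.ofEq (Ty.obj_mu h)).app i x) (.unfold t) := by
  rw [Rel, dif_pos h]

/-- Nothing is related at an ill-formed recursive type, so the closure properties need no separate
assumption of well-formedness. -/
theorem wf_of_rel_mu {A : Ty 1} {x : (Ty.mu A).obj.el i} (h : Rel (.mu A) i x t) :
    (Ty.mu A).WF := by
  rw [Rel] at h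
  by_contra hA
  rwa [dif_neg hA] at h

theorem rel_later_zero {x : (Ty.later A).obj.el 0} : Rel (.later A) 0 x t := by
  rw [Rel]; trivial

theorem rel_later_succ {x : (Ty.later A).obj.el (i + 1)} : Rel (.later A) (i + 1) x t ↔
    ∃ u, Reduces t (.next u) ∧ Rel A i x u := by rw [Rel]

theorem rel_box {a : (Ty.box A : Ty 0).obj.el i} :
    Rel (.box A) i a t ↔ ∀ j, Rel A j ((a : A.obj.Global).1 j) (.unbox t) := by rw [Rel]

end Unfolding

/-! ### Closure of the logical relation under expansion and change of stage -/

/-- The logical relation is closed under expansion. -/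
theorem Rel.expand {A : Ty 0} {i : ℕ} {x : A.obj.el i} {t u : Tm 0} (h : Reduces t u)
    (hu : Rel A i x u) : Rel A i x t :=
  match A, i, x with
  | .var k, _, _ => k.elim0
  | .nat, _, _ => rel_nat.mpr (h.trans (rel_nat.mp hu))
  | .one, _, _ => rel_one
  | .empty, _, _ => (not_rel_empty hu).elim
  -- At the types observed by elimination, the eliminators are evaluation contexts, so the given
  -- reduction can be carried out inside them.
  | .prod A B, i, x =>
      have hu := rel_prod.mp hu
      rel_prod.mpr ⟨expand (h.congr .fst) hu.1, expand (h.congr .snd) hu.2⟩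
  | .sum A B, i, .inl a =>
      have ⟨v, hv, ha⟩ := rel_inl.mp hu
      rel_inl.mpr ⟨v, h.trans hv, ha⟩
  | .sum A B, i, .inr b =>
      have ⟨v, hv, hb⟩ := rel_inr.mp hu
      rel_inr.mpr ⟨v, h.trans hv, hb⟩
  | .arr A B, i, f => rel_arr.mpr fun j x v hv =>
      expand (h.congr (f := fun t => .app t v) (.app v)) (rel_arr.mp hu j x v hv)
  | .mu A, i, x =>
      have hA := wf_of_rel_mu hu
      (rel_mu hA).mpr (expand (h.congr .unfold) ((rel_mu hA).mp hu))
  | .later A, 0, _ => rel_later_zero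
  | .later A, i + 1, _ =>
      have ⟨v, hv, ha⟩ := rel_later_succ.mp hu
      rel_later_succ.mpr ⟨v, h.trans hv, ha⟩
  | .box A, i, a => rel_box.mpr fun j => expand (h.congr .unbox) (rel_box.mp hu j)
termination_by (A.boxDepth, i, A.unguardedSize)
decreasing_by
  all_goals first
    | have h₁ := Ty.boxDepth_inst_mu ‹Ty 1›
      have h₂ := Ty.unguardedSize_inst_mu hA
      simp only [Prod.lex_def]
      lia
    | simp only [Prod.lex_def, Ty.boxDepth, Ty.unguardedSize]
      lia

/-- The logical relation is closed under restriction. -/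
theorem Rel.res {A : Ty 0} {i : ℕ} {x : A.obj.el (i + 1)} {t : Tm 0}
    (h : Rel A (i + 1) x t) : Rel A i (A.obj.res i x) t :=
  match A, i, x with
  | .var k, _, _ => k.elim0
  | .nat, _, _ => have h := rel_nat.mp h
      rel_nat.mpr h
  | .one, _, _ => rel_one
  | .empty, _, _ => (not_rel_empty h).elim
  | .prod A B, i, x =>
      have h := rel_prod.mp h
      rel_prod.mpr ⟨res h.1, res h.2⟩
  | .sum A B, i, .inl a =>
      have ⟨v, hv, ha⟩ := rel_inl.mp h
      rel_inl.mpr ⟨v, hv, res ha⟩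
  | .sum A B, i, .inr b =>
      have ⟨v, hv, hb⟩ := rel_inr.mp h
      rel_inr.mpr ⟨v, hv, res hb⟩
  | .arr A B, i, f => rel_arr.mpr fun j => rel_arr.mp h j.castSucc
  | .mu A, i, x => by
      have hA := wf_of_rel_mu h
      refine (rel_mu hA).mpr ?_
      have e := (Hom.ofEq (Ty.obj_mu hA)).nat i x
      exact e ▸ res ((rel_mu hA).mp h)
  | .later A, 0, _ => rel_later_zero
  | .later A, i + 1, _ =>
      have ⟨v, hv, ha⟩ := rel_later_succ.mp h
      rel_later_succ.mpr ⟨v, hv, res ha⟩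
  | .box A, i, a => have h := rel_box.mp h
      rel_box.mpr h
-- Here the box depth is not needed: the `box` clause is the same at all stages and the function
-- clause already covers all lower ones, so neither makes a recursive call.
termination_by (i, A.unguardedSize)
decreasing_by
  all_goals first
    | have h₂ := Ty.unguardedSize_inst_mu hA
      simp only [Prod.lex_def]
      lia
    | simp only [Prod.lex_def, Ty.unguardedSize]
      lia

theorem Ty.Constant.rename {n : ℕ} {A : Ty n} (hA : A.Constant) : ∀ {m : ℕ} (f : Fin n → Fin m),
    (A.rename f).Constant := by
  induction A with
  | prod A B ihA ihB | sum A B ihA ihB | arr A B ihA ihB =>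
    exact fun f => ⟨ihA hA.1 f, ihB hA.2 f⟩
  | mu A ih => exact fun f => ih hA _
  | later A ih => exact hA.elim
  | _ => exact fun _ => trivial

theorem Ty.Constant.subst {n : ℕ} {A : Ty n} (hA : A.Constant) : ∀ {m : ℕ} (s : Fin n → Ty m),
    (∀ k, (s k).Constant) → (A.subst s).Constant := by
  induction A with
  | var k => exact fun s h => h k
  | prod A B ihA ihB | sum A B ihA ihB | arr A B ihA ihB =>
    exact fun s h => ⟨ihA hA.1 s h, ihB hA.2 s h⟩
  | mu A ih =>
    intro m s h
    refine ih hA _ fun k => ?_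
    cases k using Fin.cases with
    | zero => trivial
    | succ k => exact (h k).rename _
  | later A ih => exact hA.elim
  | _ => exact fun _ _ => trivial

theorem Ty.Constant.inst_mu {A : Ty 1} (hA : (Ty.mu A).Constant) : (A.inst (.mu A)).Constant :=
  Ty.Constant.subst (A := A) hA _ fun k => by
    cases k using Fin.cases with
    | zero => exact hA
    | succ k => exact k.elim0

/-- At constant types the logical relation does not depend on the stage. -/
theorem Rel.of_res {A : Ty 0} (hc : A.Constant) {i : ℕ} {x : A.obj.el (i + 1)} {t : Tm 0}
    (h : Rel A i (A.obj.res i x) t) : Rel A (i + 1) x t :=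
  match A, i, x with
  | .var k, _, _ => k.elim0
  | .nat, _, _ => have h := rel_nat.mp h
      rel_nat.mpr h
  | .one, _, _ => rel_one
  | .empty, _, _ => (not_rel_empty h).elim
  | .prod A B, i, x =>
      have h := rel_prod.mp h
      rel_prod.mpr ⟨of_res hc.1 h.1, of_res hc.2 h.2⟩
  | .sum A B, i, .inl a =>
      have ⟨v, hv, ha⟩ := rel_inl.mp h
      rel_inl.mpr ⟨v, hv, of_res hc.1 ha⟩
  | .sum A B, i, .inr b =>
      have ⟨v, hv, hb⟩ := rel_inr.mp h
      rel_inr.mpr ⟨v, hv, of_res hc.2 hb⟩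
  | .arr A B, i, f => by
      refine rel_arr.mpr fun j => ?_
      cases j using Fin.lastCases with
      | cast j => exact rel_arr.mp h j
      | last =>
        -- Only the top stage is new. The argument is restricted one stage, where the hypothesis
        -- applies; naturality of `f` identifies the result with the restriction of the value of `f`
        -- at `x`, and constancy of the codomain lifts the relation back.
        intro x u hx
        refine of_res hc.2 ?_
        have e := f.2 (Fin.last i) x
        exact e ▸ rel_arr.mp h (Fin.last i) _ u hx.res
  | .mu A, i, x => by
      have hA := wf_of_rel_mu h
      refine (rel_mu hA).mpr (of_res hc.inst_mu ?_)
      have e := (Hom.ofEq (Ty.obj_mu hA)).nat i x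
      exact e ▸ (rel_mu hA).mp h
  | .later A, _, _ => hc.elim
  | .box A, i, a => have h := rel_box.mp h
      rel_box.mpr h
-- Constancy excludes `later` outside a `box`, so the size alone decreases.
termination_by A.unguardedSize
decreasing_by
  all_goals first
    | exact Ty.unguardedSize_inst_mu hA
    | simp only [Ty.unguardedSize]
      lia


/-! ### Related environments -/

/-- The logical relation between environments and closing substitutions. -/
def EnvRel {n : ℕ} (Γ : Ctx n) (i : ℕ) (γ : Γ.obj.el i) (s : Fin n → Tm 0) : Prop :=
  ∀ k, Rel (Γ k) i (γ k) (s k)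

namespace EnvRel

variable {n : ℕ} {Γ : Ctx n} {i : ℕ} {s : Fin n → Tm 0}

theorem res {γ : Γ.obj.el (i + 1)} (h : EnvRel Γ (i + 1) γ s) : EnvRel Γ i (Γ.obj.res i γ) s :=
  fun k => (h k).res

theorem restr {γ : Γ.obj.el i} (h : EnvRel Γ i γ s) {j : ℕ} (hj : j ≤ i) :
    EnvRel Γ j (Γ.obj.restr hj γ) s := by
  induction hj using Nat.decreasingInduction with
  | self => rwa [Obj.restr_self]
  | of_succ k hk ih =>
    rw [Obj.restr_succ _ hk]
    exact ih.res

theorem cons {γ : Γ.obj.el i} (h : EnvRel Γ i γ s) {A : Ty 0} {x : A.obj.el i} {u : Tm 0}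
    (hx : Rel A i x u) : EnvRel (Ctx.ext A Γ) i ((Γ.cons A).app i (γ, x)) (Fin.cons u s) := by
  intro k
  cases k using Fin.cases with
  | zero => exact hx
  | succ k => exact h k

/-- In a context of constant types, related environments are related at all stages. -/
theorem glob (hw : ∀ k, (Γ k).WF) (hc : ∀ k, (Γ k).Constant) {γ : Γ.obj.el i}
    (h : EnvRel Γ i γ s) (j : ℕ) :
    EnvRel Γ j (((Ctx.isConst_obj hw hc).glob γ).1 j) s := by
  -- The global element is built by restriction to stage `0` followed by inverses of restriction,
  -- and the relation follows the same path: down by `restr`, up by `Rel.of_res`.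
  induction j with
  | zero => exact h.restr (Nat.zero_le i)
  | succ j ih =>
    intro k
    have e := ((Ctx.isConst_obj hw hc).glob γ).2 j
    refine Rel.of_res (hc k) ?_
    have ih := ih k
    rw [← e] at ih
    exact ih

end EnvRel

/-! ### The fundamental lemma and adequacy -/

namespace Hom

theorem ofEq_app_ofEq_symm_app {X Y : Obj} (h : X = Y) (i : ℕ) (y : Y.el i) :
    (ofEq h).app i ((ofEq h.symm).app i y) = y := by
  subst h
  rfl

end Hom

namespace Obj

theorem splitGlobal_eq_inl {X Y : Obj} {a : (sum X Y).Global} {b : X.Global}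
    (h : splitGlobal a = .inl b) (i : ℕ) : a.1 i = .inl (b.1 i) := by
  unfold splitGlobal at h
  split at h
  · cases h
    exact (Sum.inl_getLeft _ _).symm
  · cases h

theorem splitGlobal_eq_inr {X Y : Obj} {a : (sum X Y).Global} {b : Y.Global}
    (h : splitGlobal a = .inr b) (i : ℕ) : a.1 i = .inr (b.1 i) := by
  unfold splitGlobal at h
  split at h
  · cases h
  · cases h
    exact (Sum.inr_getRight _ _).symm

end Obj

/-- A non-empty explicit substitution is first carried out by `prevSubst`. An empty one admits no
such step, but then substitution leaves the body unchanged and evaluation proceeds directly beneath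
`prev`. -/
theorem reduces_prev_next {m : ℕ} {s : Fin m → Tm 0} {t : Tm m} {u : Tm 0}
    (h : Reduces (t.subst s) (.next u)) : Reduces (.prev s t) u := by
  have key : ∀ {t : Tm 0} (s : Fin 0 → Tm 0), Reduces t (.next u) → Reduces (.prev s t) u :=
    fun s h => (h.congr (f := .prev s) (.prev s)).trans (Rule.prevNext s u).reduces
  rcases Nat.eq_zero_or_pos m with rfl | hm
  · exact key s (t.subst_closed s ▸ h)
  · exact (Rule.prevSubst s t hm.ne').reduces.trans (key _ h)

theorem reduces_boxSum_inl {m : ℕ} {s : Fin m → Tm 0} {t : Tm m} {u : Tm 0}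
    (h : Reduces (t.subst s) (.inl u)) : Reduces (.boxSum s t) (.inl (.box ![] u)) := by
  have key : ∀ {t : Tm 0} (s : Fin 0 → Tm 0), Reduces t (.inl u) →
      Reduces (.boxSum s t) (.inl (.box ![] u)) :=
    fun s h => (h.congr (f := .boxSum s) (.boxSum s)).trans (Rule.boxSumInl s u).reduces
  rcases Nat.eq_zero_or_pos m with rfl | hm
  · exact key s (t.subst_closed s ▸ h)
  · exact (Rule.boxSumSubst s t hm.ne').reduces.trans (key _ h)

theorem reduces_boxSum_inr {m : ℕ} {s : Fin m → Tm 0} {t : Tm m} {u : Tm 0}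
    (h : Reduces (t.subst s) (.inr u)) : Reduces (.boxSum s t) (.inr (.box ![] u)) := by
  have key : ∀ {t : Tm 0} (s : Fin 0 → Tm 0), Reduces t (.inr u) →
      Reduces (.boxSum s t) (.inr (.box ![] u)) :=
    fun s h => (h.congr (f := .boxSum s) (.boxSum s)).trans (Rule.boxSumInr s u).reduces
  rcases Nat.eq_zero_or_pos m with rfl | hm
  · exact key s (t.subst_closed s ▸ h)
  · exact (Rule.boxSumSubst s t hm.ne').reduces.trans (key _ h)

theorem Rel.box_closed {A : Ty 0} {i : ℕ} {a : A.obj.Global} {u : Tm 0}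
    (h : ∀ j, Rel A j (a.1 j) u) : Rel (.box A) i a (.box ![] u) :=
  rel_box.mpr fun j => by
    refine Rel.expand (Rule.unboxBox _ u).reduces ?_
    rw [Tm.subst_closed]
    exact h j

/-- The global element lies on one side of the sum, so at every stage the body reduces to an
injection on that side. A priori the injected term depends on the stage; since reduction is
deterministic it is always the one found at stage `0`, and boxing it gives a term related to the
whole global element. -/
theorem Rel.splitGlobal {A B : Ty 0} {i : ℕ} {a : (Obj.sum A.obj B.obj).Global} {m : ℕ}
    {s : Fin m → Tm 0} {t : Tm m} (h : ∀ j, Rel (.sum A B) j (a.1 j) (t.subst s)) :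
    Rel (.sum (.box A) (.box B)) i (Obj.splitGlobal a) (.boxSum s t) := by
  cases hx : Obj.splitGlobal a with
  | inl b =>
    have hb : ∀ j, ∃ u, Reduces (t.subst s) (.inl u) ∧ Rel A j (b.1 j) u :=
      fun j => rel_inl.mp (Obj.splitGlobal_eq_inl hx j ▸ h j)
    obtain ⟨u, hu, -⟩ := hb 0
    refine rel_inl.mpr ⟨_, reduces_boxSum_inl hu, Rel.box_closed fun j => ?_⟩
    obtain ⟨v, hv, hr⟩ := hb j
    cases hu.value_unique (.inl u) (.inl v) hv
    exact hr
  | inr b =>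
    have hb : ∀ j, ∃ u, Reduces (t.subst s) (.inr u) ∧ Rel B j (b.1 j) u :=
      fun j => rel_inr.mp (Obj.splitGlobal_eq_inr hx j ▸ h j)
    obtain ⟨u, hu, -⟩ := hb 0
    refine rel_inr.mpr ⟨_, reduces_boxSum_inr hu, Rel.box_closed fun j => ?_⟩
    obtain ⟨v, hv, hr⟩ := hb j
    cases hu.value_unique (.inr u) (.inr v) hv
    exact hr

/-- The fundamental lemma: the denotation of a term is related to each of its closing instances. -/
theorem HasType.rel {n : ℕ} {Γ : Ctx n} {t : Tm n} {A : Ty 0} (d : HasType Γ t A) :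
    ∀ (i : ℕ) (γ : Γ.obj.el i) (s : Fin n → Tm 0), EnvRel Γ i γ s →
      Rel A i (d.den.app i γ) (t.subst s) := by
  induction d with
  | var k => exact fun i γ s h => h k
  | zero => exact fun i γ s h => rel_nat.mpr .refl
  | succ d ih => exact fun i γ s h => rel_nat.mpr ((rel_nat.mp (ih i γ s h)).congr .succ)
  | unit => exact fun i γ s h => rel_one
  | pair d e ihd ihe =>
    exact fun i γ s h => rel_prod.mpr ⟨Rel.expand (Rule.fst _ _).reduces (ihd i γ s h),
      Rel.expand (Rule.snd _ _).reduces (ihe i γ s h)⟩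
  | fst d ih => exact fun i γ s h => (rel_prod.mp (ih i γ s h)).1
  | snd d ih => exact fun i γ s h => (rel_prod.mp (ih i γ s h)).2
  | abort _ d ih => exact fun i γ s h => (not_rel_empty (ih i γ s h)).elim
  | inl _ d ih => exact fun i γ s h => rel_inl.mpr ⟨_, .refl, ih i γ s h⟩
  | inr _ d ih => exact fun i γ s h => rel_inr.mpr ⟨_, .refl, ih i γ s h⟩
  | @caseOf n Γ t u₁ u₂ A B C d e₁ e₂ ihd ih₁ ih₂ =>
    intro i γ s h
    have hd := ihd i γ s h
    change Rel C i (Sum.elim _ _ (d.den.app i γ)) (.caseOf _ _ _)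
    -- Generalising the value of the scrutinee lets the denotation of the case distinction compute
    -- on each side of the sum.
    generalize d.den.app i γ = x at hd
    match x with
    | .inl a =>
      obtain ⟨u, hu, ha⟩ := rel_inl.mp hd
      refine Rel.expand ((hu.congr (f := fun t => .caseOf t _ _) (.caseOf _ _)).trans
        (Rule.caseInl u _ _).reduces) ?_
      rw [Tm.inst_subst_lift]
      exact ih₁ i _ _ (h.cons ha)
    | .inr b =>
      obtain ⟨u, hu, hb⟩ := rel_inr.mp hd
      refine Rel.expand ((hu.congr (f := fun t => .caseOf t _ _) (.caseOf _ _)).trans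
        (Rule.caseInr u _ _).reduces) ?_
      rw [Tm.inst_subst_lift]
      exact ih₂ i _ _ (h.cons hb)
  | lam _ d ih =>
    refine fun i γ s h => rel_arr.mpr fun j x u hx => ?_
    refine Rel.expand (Rule.beta _ u).reduces ?_
    rw [Tm.inst_subst_lift]
    -- An argument may arrive at any earlier stage `j`, so the environment is restricted to `j`,
    -- just as in `Hom.curry`.
    exact ih j _ _ ((h.restr (Nat.lt_succ_iff.mp j.2)).cons hx)
  | app d e ihd ihe =>
    exact fun i γ s h => rel_arr.mp (ihd i γ s h) (Fin.last i) _ _ (ihe i γ s h)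
  | fold hA d ih =>
    intro i γ s h
    refine (rel_mu hA).mpr (Rel.expand (Rule.unfoldFold _).reduces ?_)
    have e := Hom.ofEq_app_ofEq_symm_app (Ty.obj_mu hA) i (d.den.app i γ)
    exact e.symm ▸ ih i γ s h
  | unfold hA d ih => exact fun i γ s h => (rel_mu hA).mp (ih i γ s h)
  | next d ih =>
    intro i γ s h
    cases i with
    | zero => exact rel_later_zero
    -- The body is related at stage `i + 1`; `later` asks for it one stage below.
    | succ i => exact rel_later_succ.mpr ⟨_, .refl, (ih (i + 1) γ s h).res⟩
  | prev hw hc d e ihd ihe =>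
    intro i γ s h
    -- The body is evaluated at stage `i + 1`, beyond the stage at which the environment is given;
    -- constancy of its types permits this. As `i + 1` is positive, the relation at `later` does
    -- yield a reduct `next u`.
    have h' := EnvRel.glob hw hc (fun k => ihe k i γ s h) (i + 1)
    obtain ⟨u, hu, hr⟩ := rel_later_succ.mp (ihd (i + 1) _ _ h')
    exact Rel.expand (reduces_prev_next hu) hr
  | ap d e ihd ihe =>
    intro i γ s h
    cases i with
    | zero => exact rel_later_zero
    | succ i =>
      obtain ⟨u, hu, hur⟩ := rel_later_succ.mp (ihd (i + 1) γ s h)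
      obtain ⟨v, hv, hvr⟩ := rel_later_succ.mp (ihe (i + 1) γ s h)
      refine rel_later_succ.mpr ⟨.app u v, ?_, rel_arr.mp hur (Fin.last i) _ _ hvr⟩
      exact ((hu.congr (f := fun t => .ap t _) (.apLeft _)).trans
        (hv.congr (.apRight (.next u)))).trans (Rule.apNext u v).reduces
  | box hw hc d e ihd ihe =>
    refine fun i γ s h => rel_box.mpr fun j => Rel.expand (Rule.unboxBox _ _).reduces ?_
    exact ihd j _ _ (EnvRel.glob hw hc (fun k => ihe k i γ s h) j)
  | unbox d ih => exact fun i γ s h => rel_box.mp (ih i γ s h) i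
  | boxSum hw hc d e ihd ihe =>
    intro i γ s h
    exact Rel.splitGlobal (a := Hom.onGlobal d.den _) fun j =>
      ihd j _ _ (EnvRel.glob hw hc (fun k => ihe k i γ s h) j)

/-- Adequacy: a closed term of type `nat` reduces to the numeral that it denotes. -/
theorem HasType.reduces_numeral {t : Tm 0} (d : HasType ![] t .nat)
    (γ : (Ctx.obj ![]).el 0) : Reduces t (Tm.numeral (d.den.app 0 γ)) := by
  -- In the empty context the environments are vacuously related. Stage `0` suffices, as the clause
  -- for `nat` is the same at every stage.
  have h := rel_nat.mp (d.rel 0 γ Tm.var fun k => k.elim0)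
  rwa [Tm.subst_var] at h


/-! ### Compositionality of the denotation -/

/-- Away from the position `k` of the hole, one and the same derivation serves both fillings. -/
theorem HasType.exists_update {n m : ℕ} {Γ : Ctx n} {Δ : Ctx m} {s : Fin m → Tm n} {k : Fin m}
    {u₁ u₂ : Tm n} (hs : ∀ j, j ≠ k → Nonempty (HasType Γ (s j) (Δ j)))
    (hu : ∃ (e₁ : HasType Γ u₁ (Δ k)) (e₂ : HasType Γ u₂ (Δ k)), e₁.den = e₂.den) :
    ∃ (e₁ : ∀ j, HasType Γ (Function.update s k u₁ j) (Δ j))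
      (e₂ : ∀ j, HasType Γ (Function.update s k u₂ j) (Δ j)),
      (fun j => (e₁ j).den) = fun j => (e₂ j).den := by
  have h : ∀ j, ∃ (e₁ : HasType Γ (Function.update s k u₁ j) (Δ j))
      (e₂ : HasType Γ (Function.update s k u₂ j) (Δ j)), e₁.den = e₂.den := by
    intro j
    by_cases hj : j = k
    · subst hj
      rw [Function.update_self, Function.update_self]
      exact hu
    · obtain ⟨e⟩ := hs j hj
      rw [Function.update_of_ne hj, Function.update_of_ne hj]
      exact ⟨e, e, rfl⟩
  choose e₁ e₂ he using h
  exact ⟨e₁, e₂, funext he⟩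

/-- Filling the hole of a context with terms of equal denotation gives terms of equal
denotation. -/
theorem CxType.exists_den_eq {h : ℕ} {Γ₀ : Ctx h} {A₀ : Ty 0} {t₁ t₂ : Tm h}
    (d₁ : HasType Γ₀ t₁ A₀) (d₂ : HasType Γ₀ t₂ A₀) (hd : d₁.den = d₂.den)
    {n : ℕ} {Γ : Ctx n} {C : Cx h n} {A : Ty 0} (hC : CxType Γ₀ A₀ Γ C A) :
    ∃ (e₁ : HasType Γ (C.plug t₁) A) (e₂ : HasType Γ (C.plug t₂) A), e₁.den = e₂.den := by
  -- The denotation belongs to a derivation and terms carry no types, so the two derivations are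
  -- built in parallel from the same side derivations. No coherence between different derivations of
  -- one term is needed.
  induction hC with
  | hole => exact ⟨d₁, d₂, hd⟩
  | succ _ ih =>
    obtain ⟨e₁, e₂, he⟩ := ih
    exact ⟨.succ e₁, .succ e₂, by simp only [HasType.den, he]⟩
  | pairLeft _ f ih =>
    obtain ⟨e₁, e₂, he⟩ := ih
    exact ⟨.pair e₁ f, .pair e₂ f, by simp only [HasType.den, he]; rfl⟩
  | pairRight f _ ih =>
    obtain ⟨e₁, e₂, he⟩ := ih
    exact ⟨.pair f e₁, .pair f e₂, by simp only [HasType.den, he]; rfl⟩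
  | fst _ ih =>
    obtain ⟨e₁, e₂, he⟩ := ih
    exact ⟨.fst e₁, .fst e₂, by simp only [HasType.den, he]⟩
  | snd _ ih =>
    obtain ⟨e₁, e₂, he⟩ := ih
    exact ⟨.snd e₁, .snd e₂, by simp only [HasType.den, he]⟩
  | abort hA _ ih =>
    obtain ⟨e₁, e₂, he⟩ := ih
    exact ⟨.abort hA e₁, .abort hA e₂, by simp only [HasType.den, he]⟩
  | inl hB _ ih =>
    obtain ⟨e₁, e₂, he⟩ := ih
    exact ⟨.inl hB e₁, .inl hB e₂, by simp only [HasType.den, he]⟩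
  | inr hA _ ih =>
    obtain ⟨e₁, e₂, he⟩ := ih
    exact ⟨.inr hA e₁, .inr hA e₂, by simp only [HasType.den, he]⟩
  | caseScrut _ f g ih =>
    obtain ⟨e₁, e₂, he⟩ := ih
    exact ⟨.caseOf e₁ f g, .caseOf e₂ f g, by simp only [HasType.den, he]⟩
  | caseLeft f _ g ih =>
    obtain ⟨e₁, e₂, he⟩ := ih
    exact ⟨.caseOf f e₁ g, .caseOf f e₂ g, by simp only [HasType.den, he]⟩
  | caseRight f g _ ih =>
    obtain ⟨e₁, e₂, he⟩ := ih
    exact ⟨.caseOf f g e₁, .caseOf f g e₂, by simp only [HasType.den, he]⟩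
  | lam hA _ ih =>
    obtain ⟨e₁, e₂, he⟩ := ih
    exact ⟨.lam hA e₁, .lam hA e₂, by simp only [HasType.den, he]; rfl⟩
  | appLeft _ f ih =>
    obtain ⟨e₁, e₂, he⟩ := ih
    exact ⟨.app e₁ f, .app e₂ f, by simp only [HasType.den, he]⟩
  | appRight f _ ih =>
    obtain ⟨e₁, e₂, he⟩ := ih
    exact ⟨.app f e₁, .app f e₂, by simp only [HasType.den, he]⟩
  | fold hA _ ih =>
    obtain ⟨e₁, e₂, he⟩ := ih
    exact ⟨.fold hA e₁, .fold hA e₂, by simp only [HasType.den, he]⟩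
  | unfold hA _ ih =>
    obtain ⟨e₁, e₂, he⟩ := ih
    exact ⟨.unfold hA e₁, .unfold hA e₂, by simp only [HasType.den, he]⟩
  | next _ ih =>
    obtain ⟨e₁, e₂, he⟩ := ih
    exact ⟨.next e₁, .next e₂, by simp only [HasType.den, he]⟩
  | prevSubst hw hc f hs _ ih =>
    obtain ⟨e₁, e₂, he⟩ := HasType.exists_update (fun j hj => ⟨hs j hj⟩) ih
    exact ⟨.prev hw hc f e₁, .prev hw hc f e₂, by simp only [HasType.den, he]⟩
  | prevBody hw hc _ f ih =>
    obtain ⟨e₁, e₂, he⟩ := ih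
    exact ⟨.prev hw hc e₁ f, .prev hw hc e₂ f, by simp only [HasType.den, he]⟩
  | apLeft _ f ih =>
    obtain ⟨e₁, e₂, he⟩ := ih
    exact ⟨.ap e₁ f, .ap e₂ f, by simp only [HasType.den, he]⟩
  | apRight f _ ih =>
    obtain ⟨e₁, e₂, he⟩ := ih
    exact ⟨.ap f e₁, .ap f e₂, by simp only [HasType.den, he]⟩
  | boxSubst hw hc f hs _ ih =>
    obtain ⟨e₁, e₂, he⟩ := HasType.exists_update (fun j hj => ⟨hs j hj⟩) ih
    exact ⟨.box hw hc f e₁, .box hw hc f e₂, by simp only [HasType.den, he]; rfl⟩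
  | boxBody hw hc _ f ih =>
    obtain ⟨e₁, e₂, he⟩ := ih
    exact ⟨.box hw hc e₁ f, .box hw hc e₂ f, by simp only [HasType.den, he]; rfl⟩
  | unbox _ ih =>
    obtain ⟨e₁, e₂, he⟩ := ih
    exact ⟨.unbox e₁, .unbox e₂, by simp only [HasType.den, he]⟩
  | boxSumSubst hw hc f hs _ ih =>
    obtain ⟨e₁, e₂, he⟩ := HasType.exists_update (fun j hj => ⟨hs j hj⟩) ih
    exact ⟨.boxSum hw hc f e₁, .boxSum hw hc f e₂, by simp only [HasType.den, he]⟩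
  | boxSumBody hw hc _ f ih =>
    obtain ⟨e₁, e₂, he⟩ := ih
    exact ⟨.boxSum hw hc e₁ f, .boxSum hw hc e₂ f, by simp only [HasType.den, he]⟩

end GuardedLambda

/-! ### The theorem -/

theorem theorem3p3 {n : ℕ} (Γ : GuardedLambda.Ctx n) (hΓ : ∀ k, (Γ k).WF)
    (A : GuardedLambda.Ty 0) (t₁ t₂ : GuardedLambda.Tm n)
    (d₁ : GuardedLambda.HasType Γ t₁ A) (d₂ : GuardedLambda.HasType Γ t₂ A)
    (h : GuardedLambda.Provable Γ ∅ (GuardedLambda.Formula.eq A d₁ d₂)) :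
    GuardedLambda.CtxEquiv Γ A t₁ t₂ := by
  -- With no assumptions, provability says that the equaliser of the two denotations is everything,
  -- at every stage.
  have hd : d₁.den = d₂.den :=
    GuardedLambda.Hom.ext (funext fun i => funext fun γ => h i γ fun _ hψ => hψ.elim)
  intro C hC
  obtain ⟨e₁, e₂, he⟩ := hC.exists_den_eq d₁ d₂ hd
  have γ : (GuardedLambda.Ctx.obj ![]).el 0 := fun k : Fin 0 => k.elim0
  -- The common value is the numeral denoted by the first filling; `he` identifies it with the one
  -- denoted by the second.
  refine ⟨_, GuardedLambda.Tm.value_numeral _, e₁.reduces_numeral γ, ?_⟩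
  rw [he]
  exact e₂.reduces_numeral γ
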